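/- **Setting.** Let $f:\mathbb R^d\to\mathbb R$ be twice continuously differentiable with Hessian $H(x)=\nabla^2 f(x)$ satisfying $\lambda_{\min}I\preceq H(x)\preceq\lambda_{\max}I$ for all $x$, where $0<\lambda_{\min}\le\lambda_{\max}$, and $\|H(x)-H(y)\|\le L\|x-y\|$ for all $x,y$, where $L>0$. Put $\kappa=\lambda_{\max}/\lambda_{\min}$; let $x^\star$ be the minimizer of $f$, $H^\star=H(x^\star)$, and $\|v\|_{H^\star}=\sqrt{v^\top H^\star v}$. Matrix norms are spectral norms. **Oracle.** For each $x$, the noise $E(x)$ is a random symmetric $d\times d$ matrix, whose law depends measurably on $x$, with $\mathbb E[E(x)]=0$ and $\mathbb E\|E(x)\|^p\le p!\,\Upsilon_E^p/2$ for $p=2,3,\dots$. Put $\Upsilon=\Upsilon_E/\lambda_{\min}$. A query at $x_t$ returns $\hat H_t=H(x_t)+E_t$ where, conditionally on the past (a $\sigma$-algebra $\mathcal F_t$ for which $x_0,\dots,x_t,E_0,\dots,E_{t-1}$ are measurable), $E_t$ has the law of $E(x_t)$. **Algorithm.** Let $\beta\in(0,1/2)$, $\rho\in(0,1)$, let $x_0$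 be deterministic, and let $w_t=t+1$ for $t\ge-1$ and $\tilde H_{-1}=0$. For $t=0,1,2,\dots$ put $\tilde H_t=\frac{w_{t-1}}{w_t}\tilde H_{t-1}+\bigl(1-\frac{w_{t-1}}{w_t}\bigr)\hat H_t$ and solve $\tilde H_tp_t=-\nabla f(x_t)$ (any solution). If this is not solvable or $\nabla f(x_t)^\top p_t\ge0$, put $x_{t+1}=x_t$. Otherwise put $x_{t+1}=x_t+\mu_tp_t$ with $\mu_t=\rho^{j_t}$, where $j_t$ is the smallest nonnegative integer such that $f(x_t+\mu_tp_t)\le f(x_t)+\mu_t\beta\nabla f(x_t)^\top p_t$. **Parameters.** Let $\delta\in(0,1)$ with $d/\delta\ge e$, and let $\epsilon,\nu\in(0,1)$ with $$\max(\epsilon,\nu)\le\min\Bigl(\tfrac13\cdot\tfrac{0.5-\beta}{1.5-\beta},\ \tfrac1{48}\Bigr).$$ Put $\phi=\dfrac{4\rho\beta(1-\beta)(1-\epsilon)}{\kappa^2(1+\epsilon)}$, $\Delta=f(x_0)-f(x^\star)$, $M=\max(1,8\Upsilon/\epsilon)$, and $$\mathcal T_1=4M^2\log\frac{dM}{\delta},\qquad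 \mathcal T_2=\max\Bigl\{0,\ \frac1\phi\log\frac{3L^2\Delta}{\nu^2\lambda_{\min}^3}\Bigr\}\ \ (\mathcal T_2=0\text{ if }\Delta=0),\qquad \mathcal T=\mathcal T_1+\mathcal T_2,\qquad \mathcal J=\frac{4\mathcal T\kappa}{\nu},$$ $$\mathcal N_\nu=\{x:\|x-x^\star\|_{H^\star}\le\nu\lambda_{\min}^{3/2}/L\},\qquad \varrho_s=\frac{4\mathcal T\kappa}{s+1}+8\Upsilon\sqrt{\frac{\log(d(s+1)/\delta)}{s+1}}.$$ **Theorem.** One has $0<\phi<1$, $24\varrho_s\le1$ for all integers $s\ge\mathcal T+\mathcal J$, and $\varrho_s\to0$ as $s\to\infty$. With probability at least $1-\delta\pi^2/6$, all of the following hold: 1. ($R$-linear convergence) for all integers $t\ge\mathcal T_1$, $\|x_t-x^\star\|\le\bigl\{\tfrac{2}{\lambda_{\min}}\Delta(1-\phi)^{t-\mathcal T_1}\bigr\}^{1/2}$ and $\|x_t-x^\star\|_{H^\star}\le\bigl\{2\kappa\Delta(1-\phi)^{t-\mathcal T_1}\bigr\}^{1/2}$; 2. $x_t\in\mathcal N_\nu$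 for all integers $t\ge\mathcal T$; 3. ($Q$-superlinear convergence) $\|x_{s+1}-x^\star\|_{H^\star}\le12\,\varrho_s\,\|x_s-x^\star\|_{H^\star}$ for all integers $s\ge\mathcal T+\mathcal J$. -/

import Mathlib

open MeasureTheory ProbabilityTheory

noncomputable section

/-- `ℝ^d` with the Euclidean norm. -/
abbrev Vec (d : ℕ) : Type := EuclideanSpace ℝ (Fin d)

/-- Real `d × d` matrices, seen as linear maps of `ℝ^d`; the norm is the spectral norm. -/
abbrev Op (d : ℕ) : Type := Vec d →L[ℝ] Vec d

/-- The Hessian `∇² f (x)`, the derivative of the gradient at `x`. -/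
def hess {d : ℕ} (f : Vec d → ℝ) (x : Vec d) : Op d := fderiv ℝ (gradient f) x

/-- The norm `‖v‖_A = √(vᵀ A v)`. -/
def matNorm {d : ℕ} (A : Op d) (v : Vec d) : ℝ := √(inner ℝ v (A v))

/-- The random variable `X` is `K`-sub-exponential:
`E |X|^p ≤ p! K^p / 2` for `p = 2, 3, …`. -/
def IsSubExponential {Ω : Type*} [MeasurableSpace Ω] (X : Ω → ℝ) (K : ℝ) (P : Measure Ω) : Prop :=
  ∀ p : ℕ, 2 ≤ p →
    Integrable (fun ω => |X ω| ^ p) P ∧ ∫ ω, |X ω| ^ p ∂P ≤ (p.factorial : ℝ) * K ^ p / 2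

/-- `Q x` is the law of the noise matrix `E(x)` of the stochastic Hessian oracle at the point `x`.
For every `x` the noise is symmetric, has mean zero, and its spectral norm is
`ΥE`-sub-exponential. -/
structure IsSubExpNoise {d : ℕ} (Q : Kernel (Vec d) (Op d)) (ΥE : ℝ) : Prop where
  symm : ∀ x, ∀ᵐ M ∂(Q x), IsSelfAdjoint M
  integrable : ∀ x, Integrable (fun M : Op d => M) (Q x)
  mean_zero : ∀ x, ∫ M, M ∂(Q x) = 0
  subExp : ∀ x, IsSubExponential (fun M : Op d => ‖M‖) ΥE (Q x)

/-- The online average `H̃_t = (w_{t-1} / w_t) H̃_{t-1} + (1 - w_{t-1} / w_t) Ĥ_t`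
with `H̃_{-1} = 0`, of a sequence in a real vector space. -/
def hessAvg {V : Type*} [AddCommGroup V] [Module ℝ V] (w : ℤ → ℝ) (Hhat : ℕ → V) : ℕ → V
  | 0 => (w (-1) / w 0) • (0 : V) + (1 - w (-1) / w 0) • Hhat 0
  | t + 1 => (w (t : ℤ) / w ((t : ℤ) + 1)) • hessAvg w Hhat t
      + (1 - w (t : ℤ) / w ((t : ℤ) + 1)) • Hhat (t + 1)

/-- The uniform weights `w_t = t + 1`, with `w_{-1} = 0`. -/
def uniformWeights (t : ℤ) : ℝ := (t : ℝ) + 1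

/-- `j` is the smallest nonnegative integer for which `μ = ρ^j` satisfies the Armijo condition
`f (x + μ p) ≤ f x + μ β ∇f(x)ᵀ p`. -/
def IsArmijoExponent {d : ℕ} (f : Vec d → ℝ) (β ρ : ℝ) (x p : Vec d) (j : ℕ) : Prop :=
  IsLeast {j : ℕ | f (x + ρ ^ j • p) ≤ f x + ρ ^ j * β * inner ℝ (gradient f x) p} j

/-- One step `x ↦ x'` of the line-search Newton iteration with the matrix `A` in place of the
Hessian. If `A p = -∇f(x)` is not solvable, or the computed solution `p` is not a descent
direction, the step is skipped. If there are several solutions, any one may be computed. -/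
def IsNewtonStep {d : ℕ} (f : Vec d → ℝ) (β ρ : ℝ) (A : Op d) (x x' : Vec d) : Prop :=
  ((¬ ∃ p, A p = -gradient f x) ∧ x' = x) ∨
  ∃ p, A p = -gradient f x ∧
    ((0 ≤ inner ℝ (gradient f x) p ∧ x' = x) ∨
     (inner ℝ (gradient f x) p < 0 ∧ ∃ j, IsArmijoExponent f β ρ x p j ∧ x' = x + ρ ^ j • p))

/-- The random sequence `x` is produced by the stochastic Newton method with Hessian averaging,
started at the deterministic point `x₀`, where `E t` is the oracle noise in iteration `t`.
The σ-algebra `ℱ t` contains the history before the oracle call of iteration `t` (the iterates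
`x 0, …, x t` and the noise `E 0, …, E (t - 1)`), and given `ℱ t` the noise `E t` is a fresh draw
from the law `Q (x t)`. -/
structure IsAveragedNewton {d : ℕ} {Ω : Type*} {mΩ : MeasurableSpace Ω} (P : Measure Ω)
    (ℱ : Filtration ℕ mΩ) (Q : Kernel (Vec d) (Op d)) (f : Vec d → ℝ) (w : ℤ → ℝ) (β ρ : ℝ)
    (x₀ : Vec d) (x : ℕ → Ω → Vec d) (E : ℕ → Ω → Op d) : Prop where
  init : ∀ ω, x 0 ω = x₀
  measurable_iterate : ∀ t, Measurable[ℱ t] (x t)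
  measurable_noise : ∀ t, Measurable[ℱ (t + 1)] (E t)
  cond_law : ∀ t, ∀ A, MeasurableSet[ℱ t] A → ∀ B : Set (Op d), MeasurableSet B →
    P (A ∩ E t ⁻¹' B) = ∫⁻ ω in A, Q (x t ω) B ∂P
  step : ∀ ω t,
    IsNewtonStep f β ρ (hessAvg w (fun i => hess f (x i ω) + E i ω) t) (x t ω) (x (t + 1) ω)

/-- `𝒯₁ = 4 (1 ∨ 8Υ/ε)² log ((d/δ) (1 ∨ 8Υ/ε))`. -/
def timeOne (d : ℕ) (δ ε Υ : ℝ) : ℝ :=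
  4 * (max 1 (8 * Υ / ε)) ^ 2 * Real.log (d / δ * max 1 (8 * Υ / ε))

/-- The contraction factor `φ = 4 ρ β (1 - β) (1 - ε) / (κ² (1 + ε))`. -/
def linRate (β ρ ε κ : ℝ) : ℝ := 4 * ρ * β * (1 - β) * (1 - ε) / (κ ^ 2 * (1 + ε))

/-- `𝒯₂ = κ² (1 + ε) / (4 ρ β (1 - β) (1 - ε)) · log (3 L² Δ / (ν² λ_min³))`, where
`Δ = f(x₀) - f(x*)`; being a number of iterations, it is `0` where this expression is negative. -/
def timeTwo (β ρ ε ν κ lmin L Δ : ℝ) : ℝ :=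
  max 0 (κ ^ 2 * (1 + ε) / (4 * ρ * β * (1 - β) * (1 - ε)) *
    Real.log (3 * L ^ 2 * Δ / (ν ^ 2 * lmin ^ 3)))

/-- The superlinear rate at iteration `s`:
`4 𝒯 κ / (s + 1) + 8 Υ √(log (d (s + 1) / δ) / (s + 1))`. -/
def superRate (d : ℕ) (δ Υ κ T : ℝ) (s : ℕ) : ℝ :=
  4 * T * κ / (s + 1) + 8 * Υ * √(Real.log (d * (s + 1) / δ) / (s + 1))

/-- The neighborhood `𝒩_ν = {x : ‖x - x*‖_{H*} ≤ ν λ_min^{3/2} / L}`, with `H* = ∇² f (x*)`. -/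
def nbhd {d : ℕ} (f : Vec d → ℝ) (xs : Vec d) (ν lmin L : ℝ) : Set (Vec d) :=
  {x | matNorm (hess f xs) (x - xs) ≤ ν * lmin ^ (3 / 2 : ℝ) / L}

end

/-!
The proof separates a probabilistic statement about the averaged noise from a deterministic
analysis of trajectories on which this average is small.

*Noise.* The summed noise `S` is controlled through the trace exponential `tr e^{θS}`, in the manner
of Ahlswede and Winter, but no trace inequality for products of exponentials is needed: writing the
traces of `e^A` and `e^{A+X}` in eigenbases `u`, `v` of the two matrices turns the perturbation into
an average, with the doubly stochastic weights `⟪u i, v j⟫ ^ 2`, of scalar exponentials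
(`trExp_add_le`). The first-order term is exact, so it vanishes in expectation for centered noise,
and the remainder depends on `‖X‖` only, so it is bounded by the moments
(`lintegral_trExp_add_le`). Integrating out one oracle call at a time gives
`E tr e^{θS} ≤ d e^{5 n (θ Υ_E)²}`, and Markov's inequality bounds the probability that the average
of `n` samples exceeds `8 Υ_E √(log (d n / δ) / n)` by `δ / n²`
(`IsAveragedNewton.measure_noiseSum_bad_le`). The failure probabilities sum to `δ π² / 6`, and `𝒯₁`
is chosen such that from then on the bound is at most `ε λ_min`.

*Linear phase.* Once the noise average is below `ε λ_min`, the averaged matrix has its spectrum in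
`[(1 - ε) λ_min, (1 + ε) λ_max]`, whatever the iterates are. Then the line search contracts the
objective gap by `1 - φ` (`HessianBounds.gap_newtonStep_le`), and after `𝒯₂` more steps the gap is
so small that the iterates never leave the neighborhood `𝒩_ν` again.

*Superlinear phase.* After `𝒯 + 𝒥` iterations the Hessians sampled before `𝒯` have so little weight
in the average that it is close to the Hessian at the minimizer. Full steps are then accepted and
halve the error each time (`HessianBounds.matNorm_newtonStep_le`), so the errors are summable. Hence
the sum of all `s + 1` Hessian errors stays of order `𝒯 κ`; with the noise average this makes the
averaged matrix accurate up to a constant times `ϱ_s`, which is the contraction factor of a full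
step (`HessianBounds.matNorm_superlinear`).
-/

/-! ### Trace exponentials of symmetric matrices -/

/-- The symmetric part `(M + Mᵀ) / 2` of a matrix. -/
noncomputable def symPart {d : ℕ} (M : Op d) : Op d :=
  (1 / 2 : ℝ) • (M + ContinuousLinearMap.adjoint M)

/-- The trace exponential `tr e^A`. -/
noncomputable def trExp {d : ℕ} (A : Op d) : ℝ :=
  LinearMap.trace ℝ (Vec d) (NormedSpace.exp A : Op d)

lemma IsSelfAdjoint.inner_map {d : ℕ} {A : Op d} (hA : IsSelfAdjoint A) (u v : Vec d) :
    inner ℝ (A u) v = inner ℝ u (A v) :=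
  (ContinuousLinearMap.isSelfAdjoint_iff_isSymmetric.1 hA) u v

lemma IsSelfAdjoint.add_op {d : ℕ} {A B : Op d} (hA : IsSelfAdjoint A) (hB : IsSelfAdjoint B) :
    IsSelfAdjoint (A + B) :=
  ContinuousLinearMap.isSelfAdjoint_iff_isSymmetric.2 <|
    (ContinuousLinearMap.isSelfAdjoint_iff_isSymmetric.1 hA).add
      (ContinuousLinearMap.isSelfAdjoint_iff_isSymmetric.1 hB)

lemma IsSelfAdjoint.smul_op {d : ℕ} {A : Op d} (hA : IsSelfAdjoint A) (c : ℝ) :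
    IsSelfAdjoint (c • A) :=
  ContinuousLinearMap.isSelfAdjoint_iff_isSymmetric.2 fun u v => by
    simp [real_inner_smul_left, real_inner_smul_right, hA.inner_map]

lemma symPart_isSelfAdjoint {d : ℕ} (M : Op d) : IsSelfAdjoint (symPart M) := by
  unfold symPart
  rw [← ContinuousLinearMap.star_eq_adjoint]
  exact (IsSelfAdjoint.all (1 / 2 : ℝ)).smul (IsSelfAdjoint.add_star_self M)

lemma symPart_eq_self {d : ℕ} {M : Op d} (hM : IsSelfAdjoint M) : symPart M = M := by
  unfold symPart
  rw [← ContinuousLinearMap.star_eq_adjoint, hM.star_eq, ← two_smul ℝ M, smul_smul]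
  norm_num

lemma continuous_symPart {d : ℕ} : Continuous (symPart : Op d → Op d) := by
  unfold symPart
  have h : Continuous fun M : Op d => M + ContinuousLinearMap.adjoint M :=
    continuous_id.add (ContinuousLinearMap.adjoint (𝕜 := ℝ) (E := Vec d) (F := Vec d)).continuous
  exact h.const_smul (1 / 2 : ℝ)

lemma continuous_trExp {d : ℕ} : Continuous (trExp : Op d → ℝ) := by
  unfold trExp
  have h : Continuous ((LinearMap.trace ℝ (Vec d)) ∘ₗ
      (ContinuousLinearMap.coeLM ℝ : Op d →ₗ[ℝ] (Vec d →ₗ[ℝ] Vec d))) :=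
    LinearMap.continuous_of_finiteDimensional _
  let _ := NormedAlgebra.restrictScalars ℚ ℝ (Op d)
  exact h.comp NormedSpace.exp_continuous

/-- A symmetric matrix is diagonal in some orthonormal basis. -/
lemma IsSelfAdjoint.exists_eigenbasis {d : ℕ} {A : Op d} (hA : IsSelfAdjoint A) :
    ∃ (b : OrthonormalBasis (Fin d) ℝ (Vec d)) (a : Fin d → ℝ), ∀ i, A (b i) = a i • b i := by
  have hs := ContinuousLinearMap.isSelfAdjoint_iff_isSymmetric.1 hA
  exact ⟨hs.eigenvectorBasis finrank_euclideanSpace_fin, hs.eigenvalues finrank_euclideanSpace_fin,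
    fun i => hs.apply_eigenvectorBasis finrank_euclideanSpace_fin i⟩

lemma exp_apply_of_eigenvector {d : ℕ} {A : Op d} {v : Vec d} {a : ℝ} (h : A v = a • v) :
    NormedSpace.exp A v = Real.exp a • v := by
  have hpow : ∀ n : ℕ, (A ^ n) v = a ^ n • v := by
    intro n
    induction n with
    | zero => simp
    | succ n ih => rw [pow_succ, mul_apply_eq_comp, h, map_smul, ih, smul_smul, pow_succ,
        mul_comm]
  have h1 := (NormedSpace.exp_series_hasSum_exp' (𝕂 := ℝ) A).mapL
    (ContinuousLinearMap.apply ℝ (Vec d) v)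
  have h2 := (NormedSpace.exp_series_hasSum_exp' (𝕂 := ℝ) a).smul_const v
  rw [← Real.exp_eq_exp_ℝ] at h2
  have h3 : (fun n : ℕ => ContinuousLinearMap.apply ℝ (Vec d) v (((n.factorial : ℝ)⁻¹) • A ^ n))
      = fun n : ℕ => (((n.factorial : ℝ)⁻¹) • a ^ n) • v := by
    funext n
    simp [hpow, smul_smul]
  rw [h3] at h1
  exact h1.unique h2

lemma trace_mul_exp_eq_sum {d : ℕ} {A : Op d} (X : Op d) (b : OrthonormalBasis (Fin d) ℝ (Vec d))
    {a : Fin d → ℝ} (h : ∀ i, A (b i) = a i • b i) :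
    LinearMap.trace ℝ (Vec d) (X * NormedSpace.exp A : Op d)
      = ∑ i, Real.exp (a i) * inner ℝ (b i) (X (b i)) := by
  rw [LinearMap.trace_eq_sum_inner _ b]
  refine Finset.sum_congr rfl fun i _ => ?_
  simp [exp_apply_of_eigenvector (h i), inner_smul_right]

lemma trExp_eq_sum {d : ℕ} {A : Op d} (b : OrthonormalBasis (Fin d) ℝ (Vec d))
    {a : Fin d → ℝ} (h : ∀ i, A (b i) = a i • b i) : trExp A = ∑ i, Real.exp (a i) := by
  have := trace_mul_exp_eq_sum 1 b h
  rw [one_mul] at this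
  unfold trExp
  rw [this]
  simp

lemma trExp_zero {d : ℕ} : trExp (0 : Op d) = d := by
  rw [trExp_eq_sum (EuclideanSpace.basisFun (Fin d) ℝ) (a := 0) (by simp)]
  simp

lemma IsSelfAdjoint.trExp_nonneg {d : ℕ} {A : Op d} (hA : IsSelfAdjoint A) : 0 ≤ trExp A := by
  obtain ⟨b, a, h⟩ := hA.exists_eigenbasis
  rw [trExp_eq_sum b h]
  positivity

/-- If the norm of a symmetric matrix `A` exceeds `s`, then `A` or `-A` has an eigenvalue above `s`,
and this eigenvalue alone makes the trace exponential at least `e^s`. -/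
lemma IsSelfAdjoint.exp_le_trExp_add {d : ℕ} {A : Op d} (hA : IsSelfAdjoint A) {s : ℝ}
    (hs : 0 ≤ s) (h : s < ‖A‖) : Real.exp s ≤ trExp A ∨ Real.exp s ≤ trExp (-A) := by
  obtain ⟨b, a, hb⟩ := hA.exists_eigenbasis
  have hb' : ∀ i, (-A) (b i) = (-a i) • b i := fun i => by simp [hb]
  obtain ⟨i, hi⟩ : ∃ i, s < |a i| := by
    by_contra! hc
    refine h.not_ge (A.opNorm_le_bound hs fun v => ?_)
    refine abs_le_of_sq_le_sq' ?_ (by positivity) |>.2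
    rw [← b.sum_sq_inner_right (A v), mul_pow, ← b.sum_sq_inner_right v, Finset.mul_sum]
    refine Finset.sum_le_sum fun i _ => ?_
    rw [← hA.inner_map, hb, real_inner_smul_left, mul_pow]
    exact mul_le_mul_of_nonneg_right (sq_le_sq' (abs_le.1 (hc i)).1 (abs_le.1 (hc i)).2)
      (sq_nonneg _)
  have key : ∀ c : Fin d → ℝ, s < c i → Real.exp s ≤ ∑ i, Real.exp (c i) := fun c hc =>
    (Real.exp_le_exp.2 hc.le).trans
      (Finset.single_le_sum (f := fun i => Real.exp (c i)) (fun _ _ => (Real.exp_pos _).le)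
        (Finset.mem_univ i))
  rcases lt_abs.1 hi with hi | hi
  · exact Or.inl ((key _ hi).trans_eq (trExp_eq_sum b hb).symm)
  · exact Or.inr ((key (fun i => - a i) hi).trans_eq (trExp_eq_sum b hb').symm)

/-- Second-order bound for the exponential with a remainder symmetric in the two end points. -/
lemma exp_le_taylor (a b : ℝ) : Real.exp b ≤ Real.exp a + (b - a) * Real.exp a
    + (b - a) ^ 2 * (Real.exp a + Real.exp b) := by
  set x := b - a with hx
  have hb : Real.exp b = Real.exp a * Real.exp x := by rw [← Real.exp_add, hx]; ring_nf
  have h1 : x + 1 ≤ Real.exp x := Real.add_one_le_exp x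
  have h2 : Real.exp x * (1 - x) ≤ 1 := by
    have := mul_le_mul_of_nonneg_left (Real.add_one_le_exp (-x)) (Real.exp_pos x).le
    rw [← Real.exp_add] at this
    simpa [sub_eq_neg_add] using this
  have h3 : Real.exp x ≤ 1 + x + x ^ 2 * (1 + Real.exp x) := by
    have hx0 := Real.exp_pos x
    rcases le_total 0 x with h | h
    · nlinarith [mul_nonneg h (sub_nonneg.2 h2), sq_nonneg x]
    · nlinarith [mul_nonneg (neg_nonneg.2 h) (sub_nonneg.2 h1), mul_nonneg (sq_nonneg x) hx0.le]
  rw [hb]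
  nlinarith [mul_le_mul_of_nonneg_left h3 (Real.exp_pos a).le]

/-- Perturbation of the trace exponential: the first-order term is exact and the rest is
controlled by the norm of the perturbation only. The proof compares the eigenbases `u`, `v` of the
two matrices through the doubly stochastic weights `⟪u i, v j⟫ ^ 2`. -/
lemma trExp_add_le {d : ℕ} {A X : Op d} (hA : IsSelfAdjoint A) (hX : IsSelfAdjoint X) :
    trExp (A + X) ≤ trExp A + LinearMap.trace ℝ (Vec d) (X * NormedSpace.exp A : Op d)
      + ‖X‖ ^ 2 * (1 + Real.exp ‖X‖) * trExp A := by
  obtain ⟨u, a, hu⟩ := hA.exists_eigenbasis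
  have hB : IsSelfAdjoint (A + X) := hA.add_op hX
  obtain ⟨v, b, hv⟩ := hB.exists_eigenbasis
  set c : Fin d → Fin d → ℝ := fun i j => inner ℝ (u i) (v j) ^ 2 with hc
  have hrow : ∀ i, ∑ j, c i j = 1 := fun i => by
    rw [hc]; simp only [v.sum_sq_inner_left]; simp
  have hcol : ∀ j, ∑ i, c i j = 1 := fun j => by
    rw [hc]; simp only [u.sum_sq_inner_right]; simp
  have hdiff : ∀ i j, (b j - a i) * inner ℝ (u i) (v j) = inner ℝ (X (u i)) (v j) := by
    intro i j
    have h1 : inner ℝ ((A + X) (u i)) (v j) = b j * inner ℝ (u i) (v j) := by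
      rw [hB.inner_map, hv, real_inner_smul_right]
    rw [add_apply, inner_add_left, hu, real_inner_smul_left] at h1
    linarith
  have hmean : ∀ i, ∑ j, c i j * (b j - a i) = inner ℝ (u i) (X (u i)) := by
    intro i
    rw [← real_inner_comm, ← v.sum_inner_mul_inner (X (u i)) (u i)]
    refine Finset.sum_congr rfl fun j _ => ?_
    rw [← hdiff, real_inner_comm (u i) (v j), hc]; ring
  have hmean' : ∀ j, ∑ i, c i j * (b j - a i) = inner ℝ (v j) (X (v j)) := by
    intro j
    rw [← u.sum_inner_mul_inner (v j) (X (v j))]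
    refine Finset.sum_congr rfl fun i _ => ?_
    rw [← hX.inner_map, ← hdiff, real_inner_comm (u i) (v j), hc]; ring
  have hvar : ∀ i, ∑ j, c i j * (b j - a i) ^ 2 ≤ ‖X‖ ^ 2 := by
    intro i
    have : ∑ j, c i j * (b j - a i) ^ 2 = ‖X (u i)‖ ^ 2 := by
      rw [← v.sum_sq_inner_left]
      refine Finset.sum_congr rfl fun j _ => ?_
      rw [← hdiff, hc]; ring
    rw [this]
    gcongr
    simpa using X.le_opNorm (u i)
  have hvar' : ∀ j, ∑ i, c i j * (b j - a i) ^ 2 ≤ ‖X‖ ^ 2 := by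
    intro j
    have : ∑ i, c i j * (b j - a i) ^ 2 = ‖X (v j)‖ ^ 2 := by
      rw [← u.sum_sq_inner_right]
      refine Finset.sum_congr rfl fun i _ => ?_
      rw [← hX.inner_map, ← hdiff, hc]; ring
    rw [this]
    gcongr
    simpa using X.le_opNorm (v j)
  have hlow : ∀ j, inner ℝ (v j) (X (v j)) ≤ ‖X‖ := by
    intro j
    refine (real_inner_le_norm _ _).trans ?_
    simpa using X.le_opNorm (v j)
  have hsumB : ∀ F : Fin d → ℝ, ∑ j, F j = ∑ i, ∑ j, c i j * F j := by
    intro F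
    rw [Finset.sum_comm]
    simp_rw [← Finset.sum_mul, hcol, one_mul]
  have hsumA : ∀ F : Fin d → ℝ, ∑ i, F i = ∑ i, ∑ j, c i j * F i := by
    intro F
    simp_rw [← Finset.sum_mul, hrow, one_mul]
  have hc0 : ∀ i j, 0 ≤ c i j := fun i j => sq_nonneg _
  have hmono : ∑ j, Real.exp (b j) ≤ Real.exp ‖X‖ * ∑ i, Real.exp (a i) := by
    have h1 : ∀ i j, c i j * (Real.exp (b j) * (1 + ‖X‖ - (b j - a i)))
        ≤ c i j * (Real.exp ‖X‖ * Real.exp (a i)) := by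
      intro i j
      refine mul_le_mul_of_nonneg_left ?_ (hc0 i j)
      have := mul_le_mul_of_nonneg_left (Real.add_one_le_exp (‖X‖ + a i - b j))
        (Real.exp_pos (b j)).le
      rw [← Real.exp_add, show b j + (‖X‖ + a i - b j) = ‖X‖ + a i by ring, Real.exp_add] at this
      linarith
    rw [Finset.mul_sum, hsumA fun i => Real.exp ‖X‖ * Real.exp (a i)]
    refine le_trans ?_ (Finset.sum_le_sum fun i _ => Finset.sum_le_sum fun j _ => h1 i j)
    rw [Finset.sum_comm]
    refine Finset.sum_le_sum fun j _ => ?_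
    have : ∑ i, c i j * (Real.exp (b j) * (1 + ‖X‖ - (b j - a i)))
        = Real.exp (b j) * ((1 + ‖X‖) * ∑ i, c i j - ∑ i, c i j * (b j - a i)) := by
      rw [Finset.mul_sum, ← Finset.sum_sub_distrib, Finset.mul_sum]
      exact Finset.sum_congr rfl fun i _ => by ring
    rw [this, hcol, hmean']
    nlinarith [Real.exp_pos (b j), hlow j]
  rw [trExp_eq_sum v hv, trExp_eq_sum u hu, trace_mul_exp_eq_sum X u hu]
  have hfirst : ∑ j, Real.exp (b j) ≤ ∑ i, Real.exp (a i)
      + ∑ i, Real.exp (a i) * inner ℝ (u i) (X (u i))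
      + ‖X‖ ^ 2 * (∑ i, Real.exp (a i) + ∑ j, Real.exp (b j)) := by
    have h1 : ∑ i, ∑ j, c i j * ((b j - a i) ^ 2 * Real.exp (a i))
        ≤ ‖X‖ ^ 2 * ∑ i, Real.exp (a i) := by
      rw [Finset.mul_sum]
      refine Finset.sum_le_sum fun i _ => ?_
      simp_rw [← mul_assoc, ← Finset.sum_mul]
      exact mul_le_mul_of_nonneg_right (hvar i) (Real.exp_pos _).le
    have h2 : ∑ i, ∑ j, c i j * ((b j - a i) ^ 2 * Real.exp (b j))
        ≤ ‖X‖ ^ 2 * ∑ j, Real.exp (b j) := by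
      rw [Finset.mul_sum, Finset.sum_comm]
      refine Finset.sum_le_sum fun j _ => ?_
      simp_rw [← mul_assoc, ← Finset.sum_mul]
      exact mul_le_mul_of_nonneg_right (hvar' j) (Real.exp_pos _).le
    have h3 : ∑ i, Real.exp (a i) * inner ℝ (u i) (X (u i))
        = ∑ i, ∑ j, c i j * ((b j - a i) * Real.exp (a i)) := by
      refine Finset.sum_congr rfl fun i _ => ?_
      rw [← hmean, Finset.mul_sum]
      exact Finset.sum_congr rfl fun j _ => by ring
    have h4 := Finset.sum_le_sum fun i (_ : i ∈ Finset.univ) =>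
      Finset.sum_le_sum fun j (_ : j ∈ Finset.univ) =>
        mul_le_mul_of_nonneg_left (exp_le_taylor (a i) (b j)) (hc0 i j)
    simp only [mul_add, Finset.sum_add_distrib] at h4
    rw [← hsumB fun j => Real.exp (b j), ← hsumA fun i => Real.exp (a i), ← h3] at h4
    linarith
  nlinarith [mul_le_mul_of_nonneg_left hmono (sq_nonneg ‖X‖)]

/-! ### Concentration of sums of sub-exponential noise matrices -/

lemma IsSubExponential.nonneg {Ω : Type*} [MeasurableSpace Ω] {X : Ω → ℝ} {K : ℝ} {P : Measure Ω}
    (h : IsSubExponential X K P) : 0 ≤ K := by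
  have h3 := (h 3 (by norm_num)).2
  have h0 : 0 ≤ ∫ ω, |X ω| ^ 3 ∂P := integral_nonneg fun ω => by positivity
  by_contra! hK
  have : K ^ 3 < 0 := Odd.pow_neg (by decide) hK
  have h4 : (0 : ℝ) < (Nat.factorial 3 : ℝ) := by positivity
  nlinarith

/-- Expanding the exponential, the moment of order `k + 2` enters with the factor
`(k + 2)! / (2 * k!) = (k + 2).choose 2`, which leaves the series of `1 / (1 - z) ^ 3`. -/
lemma IsSubExponential.lintegral_sq_mul_exp_le {Ω : Type*} [MeasurableSpace Ω] {X : Ω → ℝ} {K : ℝ}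
    {P : Measure Ω} (h : IsSubExponential X K P) (hX : Measurable X) {τ : ℝ} (hτ : 0 ≤ τ)
    (hz : τ * K < 1) :
    ∫⁻ ω, ENNReal.ofReal ((τ * |X ω|) ^ 2 * Real.exp (τ * |X ω|)) ∂P
      ≤ ENNReal.ofReal ((τ * K) ^ 2 * (1 / (1 - τ * K) ^ 3)) := by
  have hK := h.nonneg
  have hz0 : 0 ≤ τ * K := by positivity
  have hexp : ∀ ω, ENNReal.ofReal ((τ * |X ω|) ^ 2 * Real.exp (τ * |X ω|))
      = ∑' k : ℕ, ENNReal.ofReal ((τ * |X ω|) ^ (k + 2) / k.factorial) := by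
    intro ω
    have hs := (NormedSpace.expSeries_div_hasSum_exp (τ * |X ω|)).mul_left ((τ * |X ω|) ^ 2)
    rw [← Real.exp_eq_exp_ℝ] at hs
    rw [← hs.tsum_eq, ENNReal.ofReal_tsum_of_nonneg (fun n => by positivity) hs.summable]
    refine tsum_congr fun k => ?_
    congr 1
    ring
  simp_rw [hexp]
  rw [lintegral_tsum fun k => (by fun_prop)]
  have hgeo := (hasSum_choose_mul_geometric_of_norm_lt_one (𝕜 := ℝ) 2 (r := τ * K)
    (by rwa [Real.norm_of_nonneg hz0])).mul_left ((τ * K) ^ 2)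
  rw [← hgeo.tsum_eq, ENNReal.ofReal_tsum_of_nonneg (fun n => by positivity) hgeo.summable]
  refine ENNReal.tsum_le_tsum fun k => ?_
  obtain ⟨hi, hle⟩ := h (k + 2) (by omega)
  have hrw : ∀ ω, (τ * |X ω|) ^ (k + 2) / k.factorial
      = (τ ^ (k + 2) / k.factorial) * |X ω| ^ (k + 2) := fun ω => by ring
  simp_rw [hrw]
  rw [← ofReal_integral_eq_lintegral_ofReal (hi.const_mul _)
    (Filter.Eventually.of_forall fun ω => by positivity), integral_const_mul]
  refine ENNReal.ofReal_le_ofReal ?_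
  refine (mul_le_mul_of_nonneg_left hle (by positivity)).trans_eq ?_
  have hch : ((k + 2).factorial : ℝ) = ((k + 2).choose 2 : ℝ) * 2 * k.factorial := by
    have := Nat.choose_mul_factorial_mul_factorial (show 2 ≤ k + 2 by omega)
    rw [show k + 2 - 2 = k by omega, Nat.factorial_two] at this
    exact_mod_cast this.symm
  have hk : (k.factorial : ℝ) ≠ 0 := by positivity
  rw [hch, mul_pow, mul_pow, pow_add τ, pow_add K]
  field_simp

/-- Moment generating function of a centered symmetric noise matrix, in the presence of a symmetric
matrix `A`. -/
lemma lintegral_trExp_add_le {d : ℕ} {μ : Measure (Op d)} [IsProbabilityMeasure μ] {K : ℝ}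
    (hsymm : ∀ᵐ M ∂μ, IsSelfAdjoint M) (hint : Integrable (fun M : Op d => M) μ)
    (hmean : ∫ M, M ∂μ = 0) (hsub : IsSubExponential (fun M : Op d => ‖M‖) K μ)
    {A : Op d} (hA : IsSelfAdjoint A) {θ : ℝ} (hθ : |θ| * K ≤ 1 / 3) :
    ∫⁻ M, ENNReal.ofReal (trExp (A + θ • symPart M)) ∂μ
      ≤ ENNReal.ofReal (Real.exp (5 * (|θ| * K) ^ 2)) * ENNReal.ofReal (trExp A) := by
  have hK := hsub.nonneg
  have hA0 := hA.trExp_nonneg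
  set ρ : Op d → ℝ := fun M => |θ| * |‖M‖| with hρ
  let ℓ : Op d →L[ℝ] ℝ := (LinearMap.toContinuousLinearMap
    ((LinearMap.trace ℝ (Vec d)) ∘ₗ
      (ContinuousLinearMap.coeLM ℝ : Op d →ₗ[ℝ] (Vec d →ₗ[ℝ] Vec d)))).comp
      ((ContinuousLinearMap.compL ℝ (Vec d) (Vec d) (Vec d)).flip (NormedSpace.exp A))
  have hℓ : ∀ M, ℓ M = LinearMap.trace ℝ (Vec d) (M * NormedSpace.exp A : Op d) := fun M => rfl
  have hsq : Integrable (fun M => ρ M ^ 2) μ := by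
    simp_rw [hρ, mul_pow]
    exact (hsub 2 le_rfl).1.const_mul _
  have hsq_le : ∫ M, ρ M ^ 2 ∂μ ≤ (|θ| * K) ^ 2 := by
    simp_rw [hρ, mul_pow]
    rw [integral_const_mul]
    refine mul_le_mul_of_nonneg_left ((hsub 2 le_rfl).2.trans_eq ?_) (by positivity)
    rw [Nat.factorial_two]; push_cast; ring
  have hexp_lint := hsub.lintegral_sq_mul_exp_le measurable_norm (abs_nonneg θ) (by linarith)
  have hexp_int : Integrable (fun M => ρ M ^ 2 * Real.exp (ρ M)) μ := by
    refine ⟨by fun_prop, ?_⟩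
    rw [hasFiniteIntegral_iff_ofReal (Filter.Eventually.of_forall fun M => by positivity)]
    exact hexp_lint.trans_lt ENNReal.ofReal_lt_top
  have hexp_le : ∫ M, ρ M ^ 2 * Real.exp (ρ M) ∂μ ≤ 27 / 8 * (|θ| * K) ^ 2 := by
    rw [← ofReal_integral_eq_lintegral_ofReal hexp_int
      (Filter.Eventually.of_forall fun M => by positivity),
      ENNReal.ofReal_le_ofReal_iff (by
        have : 0 < 1 - |θ| * K := by linarith
        positivity)] at hexp_lint
    refine hexp_lint.trans ?_
    rw [mul_comm]
    refine mul_le_mul_of_nonneg_right ?_ (by positivity)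
    rw [div_le_iff₀ (by have : 0 < 1 - |θ| * K := by linarith
                        positivity)]
    have : (2 / 3 : ℝ) ^ 3 ≤ (1 - |θ| * K) ^ 3 :=
      pow_le_pow_left₀ (by norm_num) (by linarith) 3
    linarith
  set g : Op d → ℝ := fun M => trExp A + θ * ℓ M + (ρ M ^ 2 + ρ M ^ 2 * Real.exp (ρ M)) * trExp A
    with hg
  have hle : ∀ᵐ M ∂μ, trExp (A + θ • symPart M) ≤ g M := by
    filter_upwards [hsymm] with M hM
    have h1 := trExp_add_le hA (hM.smul_op θ)
    rw [symPart_eq_self hM]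
    refine h1.trans_eq ?_
    have h2 : LinearMap.trace ℝ (Vec d) ((θ • M) * NormedSpace.exp A : Op d) = θ * ℓ M := by
      rw [← hℓ, map_smul, smul_eq_mul]
    have h3 : ‖θ • M‖ = ρ M := by rw [hρ, norm_smul, Real.norm_eq_abs]; simp
    rw [h2, h3, hg]
    ring
  have hℓint : Integrable (fun M => ℓ M) μ := ℓ.integrable_comp hint
  have hℓ0 : ∫ M, ℓ M ∂μ = 0 := by
    rw [ℓ.integral_comp_comm hint, hmean, map_zero]
  have hi₁ : Integrable (fun M => trExp A + θ * ℓ M) μ :=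
    (integrable_const _).add (hℓint.const_mul θ)
  have hi₂ : Integrable (fun M => ρ M ^ 2 + ρ M ^ 2 * Real.exp (ρ M)) μ := hsq.add hexp_int
  have hgint : Integrable g μ := hi₁.add (hi₂.mul_const _)
  have hgval : ∫ M, g M ∂μ ≤ Real.exp (5 * (|θ| * K) ^ 2) * trExp A := by
    have : ∫ M, g M ∂μ = trExp A
        + (∫ M, ρ M ^ 2 ∂μ + ∫ M, ρ M ^ 2 * Real.exp (ρ M) ∂μ) * trExp A := by
      rw [hg, integral_add hi₁ (hi₂.mul_const _), integral_add (integrable_const _)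
        (hℓint.const_mul θ), integral_const_mul, hℓ0, integral_mul_const,
        integral_add hsq hexp_int]
      simp
    rw [this]
    have h1 := Real.add_one_le_exp (5 * (|θ| * K) ^ 2)
    nlinarith [mul_le_mul_of_nonneg_right h1 hA0, sq_nonneg (|θ| * K),
      mul_nonneg (sq_nonneg (|θ| * K)) hA0,
      mul_le_mul_of_nonneg_right (add_le_add hsq_le hexp_le) hA0]
  have hg0 : 0 ≤ᵐ[μ] g := by
    filter_upwards [hle] with M hM
    exact (hA.add_op ((symPart_isSelfAdjoint M).smul_op θ)).trExp_nonneg.trans hM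
  calc ∫⁻ M, ENNReal.ofReal (trExp (A + θ • symPart M)) ∂μ
      ≤ ∫⁻ M, ENNReal.ofReal (g M) ∂μ :=
        lintegral_mono_ae (hle.mono fun M hM => ENNReal.ofReal_le_ofReal hM)
    _ = ENNReal.ofReal (∫ M, g M ∂μ) := (ofReal_integral_eq_lintegral_ofReal hgint hg0).symm
    _ ≤ _ := by
        rw [← ENNReal.ofReal_mul (Real.exp_pos _).le]
        exact ENNReal.ofReal_le_ofReal hgval

section Run

variable {d : ℕ} {Ω : Type*} {mΩ : MeasurableSpace Ω} {P : Measure Ω}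
  {ℱ : Filtration ℕ mΩ} {Q : Kernel (Vec d) (Op d)} {f : Vec d → ℝ} {w : ℤ → ℝ}
  {β ρ : ℝ} {x₀ : Vec d} {x : ℕ → Ω → Vec d} {E : ℕ → Ω → Op d}

/-- Integrating out the fresh noise `E t`, given anything known before the oracle call. -/
lemma IsAveragedNewton.lintegral_noise [IsProbabilityMeasure P] [IsMarkovKernel Q]
    (hrun : IsAveragedNewton P ℱ Q f w β ρ x₀ x E) (t : ℕ)
    {S : Ω → Op d} (hS : Measurable[ℱ t] S) {G : Op d × Op d → ENNReal} (hG : Measurable G) :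
    ∫⁻ ω, G (S ω, E t ω) ∂P = ∫⁻ ω, ∫⁻ M, G (S ω, M) ∂(Q (x t ω)) ∂P := by
  have hE : Measurable (E t) := (hrun.measurable_noise t).mono (ℱ.le (t + 1)) le_rfl
  have hxS : Measurable[ℱ t] fun ω => (x t ω, S ω) := (hrun.measurable_iterate t).prodMk hS
  have hxS' : Measurable fun ω => (x t ω, S ω) := hxS.mono (ℱ.le t) le_rfl
  let κ : Kernel (Vec d × Op d) (Op d) := Q.comap Prod.fst measurable_fst
  have hlaw : P.map (fun ω => ((x t ω, S ω), E t ω)) = (P.map fun ω => (x t ω, S ω)) ⊗ₘ κ := by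
    have : IsProbabilityMeasure (P.map fun ω => ((x t ω, S ω), E t ω)) :=
      Measure.isProbabilityMeasure_map (hxS'.prodMk hE).aemeasurable
    have : IsProbabilityMeasure (P.map fun ω => (x t ω, S ω)) :=
      Measure.isProbabilityMeasure_map hxS'.aemeasurable
    refine Measure.ext_prod fun {A B} hA hB => ?_
    rw [Measure.map_apply (hxS'.prodMk hE) (hA.prod hB), Measure.compProd_apply_prod hA hB,
      setLIntegral_map hA (κ.measurable_coe hB) hxS']
    exact hrun.cond_law t _ (hxS hA) B hB
  have hG' : Measurable fun p : (Vec d × Op d) × Op d => G (p.1.2, p.2) := by fun_prop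
  have h1 := lintegral_map (μ := P) hG' (hxS'.prodMk hE)
  rw [hlaw, Measure.lintegral_compProd hG', lintegral_map (by fun_prop) hxS'] at h1
  exact h1.symm

/-- Oracle noise almost surely has every property that its conditional law has. -/
lemma IsAveragedNewton.ae_noise (hrun : IsAveragedNewton P ℱ Q f w β ρ x₀ x E) (t : ℕ)
    {p : Op d → Prop} (hp : MeasurableSet {M | p M}) (h : ∀ y, ∀ᵐ M ∂(Q y), p M) :
    ∀ᵐ ω ∂P, p (E t ω) := by
  have h1 := hrun.cond_law t Set.univ MeasurableSet.univ {M | p M}ᶜ hp.compl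
  rw [Set.univ_inter] at h1
  rw [ae_iff]
  refine Eq.trans h1 ?_
  have h2 : ∀ ω, Q (x t ω) {M | p M}ᶜ = 0 := fun ω => ae_iff.1 (h (x t ω))
  simp [h2]

/-- The sum of the symmetrized noise of the first `n` oracle calls. -/
noncomputable def noiseSum {d : ℕ} {Ω : Type*} (E : ℕ → Ω → Op d) (n : ℕ) (ω : Ω) : Op d :=
  ∑ i ∈ Finset.range n, symPart (E i ω)

lemma IsAveragedNewton.measurable_noiseSum (hrun : IsAveragedNewton P ℱ Q f w β ρ x₀ x E) (n : ℕ) :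
    Measurable[ℱ n] (noiseSum E n) := by
  unfold noiseSum
  refine Finset.measurable_fun_sum _ fun i hi => ?_
  exact continuous_symPart.measurable.comp
    ((hrun.measurable_noise i).mono (ℱ.mono (Finset.mem_range.1 hi)) le_rfl)

lemma noiseSum_isSelfAdjoint {d : ℕ} {Ω : Type*} (E : ℕ → Ω → Op d) (n : ℕ) (ω : Ω) :
    IsSelfAdjoint (noiseSum E n ω) := by
  unfold noiseSum
  induction n with
  | zero =>
    rw [Finset.range_zero, Finset.sum_empty, ContinuousLinearMap.isSelfAdjoint_iff_isSymmetric]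
    exact LinearMap.IsSymmetric.zero
  | succ n ih => rw [Finset.sum_range_succ]; exact ih.add_op (symPart_isSelfAdjoint _)

lemma IsAveragedNewton.lintegral_trExp_noiseSum_le [IsProbabilityMeasure P] [IsMarkovKernel Q]
    {ΥE : ℝ}
    (hrun : IsAveragedNewton P ℱ Q f w β ρ x₀ x E) (hQ : IsSubExpNoise Q ΥE) {θ : ℝ}
    (hθ : |θ| * ΥE ≤ 1 / 3) (n : ℕ) :
    ∫⁻ ω, ENNReal.ofReal (trExp (θ • noiseSum E n ω)) ∂P
      ≤ ENNReal.ofReal (Real.exp (n * (5 * (|θ| * ΥE) ^ 2)) * d) := by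
  induction n with
  | zero => simp [noiseSum, trExp_zero]
  | succ n ih =>
    have hG : Measurable fun p : Op d × Op d =>
        ENNReal.ofReal (trExp (θ • p.1 + θ • symPart p.2)) :=
      (continuous_trExp.comp ((continuous_fst.const_smul θ).add
        ((continuous_symPart.comp continuous_snd).const_smul θ))).measurable.ennreal_ofReal
    have h1 := hrun.lintegral_noise n (hrun.measurable_noiseSum n) hG
    have h2 : ∀ ω, θ • noiseSum E (n + 1) ω = θ • noiseSum E n ω + θ • symPart (E n ω) := by
      intro ω
      rw [noiseSum, Finset.sum_range_succ, smul_add, noiseSum]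
    simp_rw [h2]
    rw [h1]
    calc _ ≤ ∫⁻ ω, ENNReal.ofReal (Real.exp (5 * (|θ| * ΥE) ^ 2))
            * ENNReal.ofReal (trExp (θ • noiseSum E n ω)) ∂P :=
          lintegral_mono fun ω => lintegral_trExp_add_le (hQ.symm _) (hQ.integrable _)
            (hQ.mean_zero _) (hQ.subExp _) ((noiseSum_isSelfAdjoint E n ω).smul_op θ) hθ
      _ ≤ ENNReal.ofReal (Real.exp (5 * (|θ| * ΥE) ^ 2))
            * ENNReal.ofReal (Real.exp (n * (5 * (|θ| * ΥE) ^ 2)) * d) := by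
          rw [lintegral_const_mul' _ _ ENNReal.ofReal_ne_top]
          gcongr
      _ = _ := by
          rw [← ENNReal.ofReal_mul (Real.exp_pos _).le, ← mul_assoc, ← Real.exp_add]
          congr 4
          push_cast; ring

/-- Exponential tail bound for the norm of the summed noise. -/
lemma IsAveragedNewton.measure_noiseSum_gt_le [IsProbabilityMeasure P] [IsMarkovKernel Q]
    {ΥE : ℝ}
    (hrun : IsAveragedNewton P ℱ Q f w β ρ x₀ x E) (hQ : IsSubExpNoise Q ΥE) {θ : ℝ}
    (hθ0 : 0 ≤ θ) (hθ : θ * ΥE ≤ 1 / 3) (n : ℕ) {s : ℝ} (hs : 0 ≤ s) :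
    P {ω | s < ‖noiseSum E n ω‖}
      ≤ ENNReal.ofReal (2 * d * Real.exp (n * (5 * (θ * ΥE) ^ 2) - θ * s)) := by
  rcases hθ0.eq_or_lt with rfl | hθpos
  · -- For `θ = 0` the bound `2 * d` is trivial, except in dimension zero.
    rcases Nat.eq_zero_or_pos d with rfl | hd
    · have : ∀ ω, ‖noiseSum E n ω‖ = 0 := fun ω => by
        rw [norm_eq_zero]; ext v i; exact i.elim0
      simp [this, hs.not_gt]
    · refine prob_le_one.trans ?_
      rw [← ENNReal.ofReal_one]
      refine ENNReal.ofReal_le_ofReal ?_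
      have : (1 : ℝ) ≤ d := by exact_mod_cast hd
      simp; linarith
  have hS : Measurable (noiseSum E n) := (hrun.measurable_noiseSum n).mono (ℱ.le n) le_rfl
  have hmark : ∀ η : ℝ, |η| = θ → P {ω | Real.exp (θ * s) ≤ trExp (η • noiseSum E n ω)}
      ≤ ENNReal.ofReal (d * Real.exp (n * (5 * (θ * ΥE) ^ 2) - θ * s)) := by
    intro η hη
    have h1 := hrun.lintegral_trExp_noiseSum_le hQ (θ := η) (by rwa [hη]) n
    have hmeas : Measurable fun ω => ENNReal.ofReal (trExp (η • noiseSum E n ω)) :=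
      ((continuous_trExp.comp (continuous_const_smul η)).measurable.comp hS).ennreal_ofReal
    have h2 := (mul_meas_ge_le_lintegral₀ (μ := P) hmeas.aemeasurable
      (ENNReal.ofReal (Real.exp (θ * s)))).trans h1
    have h3 : {ω | Real.exp (θ * s) ≤ trExp (η • noiseSum E n ω)} ⊆
        {ω | ENNReal.ofReal (Real.exp (θ * s)) ≤ ENNReal.ofReal (trExp (η • noiseSum E n ω))} :=
      fun ω hω => ENNReal.ofReal_le_ofReal hω
    have h4 : ENNReal.ofReal (Real.exp (θ * s)) ≠ 0 := by
      simpa using Real.exp_pos (θ * s)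
    refine (measure_mono h3).trans ?_
    rw [mul_comm, ← ENNReal.le_div_iff_mul_le (Or.inl h4) (Or.inl ENNReal.ofReal_ne_top)] at h2
    refine h2.trans_eq ?_
    rw [← ENNReal.ofReal_div_of_pos (Real.exp_pos _), hη]
    congr 1
    rw [Real.exp_sub]; ring
  have hsub : {ω | s < ‖noiseSum E n ω‖} ⊆
      {ω | Real.exp (θ * s) ≤ trExp (θ • noiseSum E n ω)}
        ∪ {ω | Real.exp (θ * s) ≤ trExp ((-θ) • noiseSum E n ω)} := by
    intro ω hω
    have h1 : θ * s < ‖θ • noiseSum E n ω‖ := by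
      rw [norm_smul, Real.norm_of_nonneg hθ0]
      exact mul_lt_mul_of_pos_left hω hθpos
    have h2 := ((noiseSum_isSelfAdjoint E n ω).smul_op θ).exp_le_trExp_add (by positivity) h1
    rw [← neg_smul θ (noiseSum E n ω)] at h2
    exact h2
  refine (measure_mono hsub).trans ((measure_union_le _ _).trans ?_)
  refine (add_le_add (hmark θ (abs_of_nonneg hθ0)) (hmark (-θ) (by
    rw [abs_neg, abs_of_nonneg hθ0]))).trans_eq ?_
  rw [← ENNReal.ofReal_add (by positivity) (by positivity)]
  congr 1; ring

/-- The noise average of `n` oracle calls exceeds its high-probability bound with probability at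
most `δ / n ^ 2`, once `n` is at least the logarithm in this bound. -/
lemma IsAveragedNewton.measure_noiseSum_bad_le [IsProbabilityMeasure P] [IsMarkovKernel Q]
    {ΥE δ : ℝ}
    (hrun : IsAveragedNewton P ℱ Q f w β ρ x₀ x E) (hQ : IsSubExpNoise Q ΥE)
    (hδ : 0 < δ) (hdδ : Real.exp 1 ≤ d / δ) {n : ℕ} (hn : 1 ≤ n)
    (hlog : Real.log (d * n / δ) ≤ n) :
    P {ω | n * (8 * ΥE * √(Real.log (d * n / δ) / n)) < ‖noiseSum E n ω‖}
      ≤ ENNReal.ofReal (δ * (1 / (n : ℝ) ^ 2)) := by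
  have hK : 0 ≤ ΥE := (hQ.subExp x₀).nonneg
  rcases hK.eq_or_lt with rfl | hKpos
  · -- With `ΥE = 0` the choice of `θ` below is meaningless, but the noise vanishes almost surely.
    have hzero : ∀ i, ∀ᵐ ω ∂P, E i ω = 0 := by
      refine fun i => hrun.ae_noise i (p := fun M => M = 0) (measurableSet_singleton 0) fun y => ?_
      have h2 := hQ.subExp y 2 le_rfl
      have h3 : ∫ M : Op d, |‖M‖| ^ 2 ∂(Q y) = 0 :=
        le_antisymm (by simpa using h2.2) (integral_nonneg fun _ => by positivity)
      rw [integral_eq_zero_iff_of_nonneg (fun _ => by positivity) h2.1] at h3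
      filter_upwards [h3] with M hM
      simpa using hM
    have : ∀ᵐ ω ∂P, ¬ (n * (8 * 0 * √(Real.log (d * n / δ) / n)) < ‖noiseSum E n ω‖) := by
      filter_upwards [ae_all_iff.2 hzero] with ω hω
      simp [noiseSum, hω, symPart_eq_self (IsSelfAdjoint.zero (Op d))]
    exact (measure_eq_zero_iff_ae_notMem.2 this).trans_le zero_le
  set l := Real.log (d * n / δ) with hl
  have hn' : (1 : ℝ) ≤ n := by exact_mod_cast hn
  have hdn : Real.exp 1 ≤ d * n / δ := by
    rw [mul_div_right_comm]
    nlinarith [Real.exp_pos 1]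
  have hdn0 : 0 < d * n / δ := (Real.exp_pos 1).trans_le hdn
  have hl1 : 1 ≤ l := (Real.le_log_iff_exp_le hdn0).2 hdn
  set q := √(l / n) with hq
  have hq0 : 0 ≤ q := Real.sqrt_nonneg _
  have hqsq : n * q ^ 2 = l := by
    rw [hq, Real.sq_sqrt (by positivity)]; field_simp
  have hq1 : q ≤ 1 := Real.sqrt_le_one.2 ((div_le_one (by positivity)).2 hlog)
  have hθ : q / (3 * ΥE) * ΥE = q / 3 := by field_simp
  refine (hrun.measure_noiseSum_gt_le hQ (θ := q / (3 * ΥE)) (by positivity)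
    (by rw [hθ]; linarith) n (by positivity)).trans (ENNReal.ofReal_le_ofReal ?_)
  -- With `θ = q / (3 ΥE)` the exponent is `(5 / 9 - 8 / 3) * l ≤ -2 * l`; a multiple `2` of `l` is
  -- what makes the bound decay like `1 / n ^ 2`.
  have h1 : n * (5 * (q / (3 * ΥE) * ΥE) ^ 2) - q / (3 * ΥE) * (n * (8 * ΥE * q)) ≤ -2 * l := by
    rw [hθ]
    have : q / (3 * ΥE) * (n * (8 * ΥE * q)) = 8 / 3 * (n * q ^ 2) := by field_simp
    rw [this, div_pow]
    have : n * (5 * (q ^ 2 / 3 ^ 2)) = 5 / 9 * (n * q ^ 2) := by ring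
    rw [this, hqsq]; linarith
  have h2 : Real.exp (-2 * l) = (δ / (d * n)) ^ 2 := by
    rw [show -2 * l = -l + -l by ring, Real.exp_add, Real.exp_neg, hl, Real.exp_log hdn0]
    rw [inv_div]; ring
  have hd : 0 < (d : ℝ) := by
    by_contra! h
    have := (Real.exp_pos 1).trans_le hdδ
    exact (div_nonpos_of_nonpos_of_nonneg h hδ.le).not_gt this
  calc _ ≤ 2 * d * (δ / (d * n)) ^ 2 := by
        rw [← h2]; gcongr
    _ ≤ _ := by
        have h3 : 2 ≤ d / δ := by linarith [Real.add_one_le_exp (1 : ℝ)]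
        rw [le_div_iff₀ hδ] at h3
        have h4 : 2 * d * (δ / (d * n)) ^ 2 = (2 * δ / d) * (δ * (1 / (n : ℝ) ^ 2)) := by
          field_simp
        rw [h4]
        exact mul_le_of_le_one_left (by positivity) ((div_le_one hd).2 h3)

end Run

/-! ### Strongly convex functions with Lipschitz Hessian -/

/-- The standing assumptions on the objective: `f` is `C²`, its Hessian has spectrum in
`[lmin, lmax]` and is `L`-Lipschitz. -/
structure HessianBounds {d : ℕ} (f : Vec d → ℝ) (lmin lmax L : ℝ) : Prop where
  contDiff : ContDiff ℝ 2 f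
  lmin_pos : 0 < lmin
  le : lmin ≤ lmax
  lower : ∀ x v, lmin * ‖v‖ ^ 2 ≤ inner ℝ v (hess f x v)
  upper : ∀ x v, inner ℝ v (hess f x v) ≤ lmax * ‖v‖ ^ 2
  L_pos : 0 < L
  lip : ∀ x y, ‖hess f x - hess f y‖ ≤ L * ‖x - y‖

lemma le_taylor_two_of_deriv_le {h h' h'' : ℝ → ℝ} (hd : ∀ s, HasDerivAt h (h' s) s)
    (hd' : ∀ s, HasDerivAt h' (h'' s) s) {m : ℝ} (hm : ∀ s ∈ Set.Icc (0 : ℝ) 1, h'' s ≤ m) :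
    h 1 ≤ h 0 + h' 0 + m / 2 := by
  have h1 : ∀ s ∈ Set.Icc (0 : ℝ) 1, h' s ≤ h' 0 + m * s := by
    have hder : ∀ s, HasDerivAt (fun s => h' s - m * s) (h'' s - m * 1) s := fun s =>
      (hd' s).sub ((hasDerivAt_id s).const_mul m)
    have := antitoneOn_of_deriv_nonpos (convex_Icc (0 : ℝ) 1)
      (fun s _ => (hder s).continuousAt.continuousWithinAt)
      (fun s _ => (hder s).differentiableAt.differentiableWithinAt)
      (fun s hs => by
        rw [(hder s).deriv]
        have := hm s (interior_subset hs)
        linarith)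
    intro s hs
    have := this (Set.left_mem_Icc.2 zero_le_one) hs hs.1
    simp only [mul_zero, sub_zero] at this
    linarith
  have hder : ∀ s, HasDerivAt (fun s => h s - (h' 0 * s + m / 2 * s ^ 2))
      (h' s - (h' 0 * 1 + m / 2 * (2 * s))) s := fun s =>
    (hd s).sub (((hasDerivAt_id s).const_mul _).add
      (((hasDerivAt_pow 2 s).const_mul (m / 2)).congr_deriv (by norm_num)))
  have := antitoneOn_of_deriv_nonpos (convex_Icc (0 : ℝ) 1)
    (fun s _ => (hder s).continuousAt.continuousWithinAt)
    (fun s _ => (hder s).differentiableAt.differentiableWithinAt)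
    (fun s hs => by
      rw [(hder s).deriv]
      have := h1 s (interior_subset hs)
      linarith)
    (Set.left_mem_Icc.2 zero_le_one) (Set.right_mem_Icc.2 zero_le_one) zero_le_one
  simp only [mul_zero, mul_one, one_pow] at this
  norm_num at this
  linarith

/-- A coercive matrix equation is solvable. -/
lemma exists_apply_eq_of_coercive {d : ℕ} {A : Op d} {c : ℝ} (hc : 0 < c)
    (hA : ∀ v, c * ‖v‖ ^ 2 ≤ inner ℝ v (A v)) (y : Vec d) : ∃ p, A p = y := by
  have hinj : Function.Injective (A : Vec d →ₗ[ℝ] Vec d) := by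
    rw [← LinearMap.ker_eq_bot, LinearMap.ker_eq_bot']
    intro v hv
    have h1 := hA v
    have h2 : A v = 0 := hv
    rw [h2, inner_zero_right] at h1
    have h3 : ‖v‖ ^ 2 ≤ 0 := by
      by_contra! h
      exact h1.not_gt (mul_pos hc h)
    exact norm_eq_zero.1 (pow_eq_zero_iff (two_ne_zero) |>.1 (le_antisymm h3 (sq_nonneg _)))
  exact LinearMap.injective_iff_surjective.1 hinj y

lemma IsSelfAdjoint.norm_map_sq_le {d : ℕ} {A : Op d} (hA : IsSelfAdjoint A) {b : ℝ} (hb : 0 < b)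
    (h0 : ∀ v, 0 ≤ inner ℝ v (A v)) (h1 : ∀ v, inner ℝ v (A v) ≤ b * ‖v‖ ^ 2) (v : Vec d) :
    ‖A v‖ ^ 2 ≤ b * inner ℝ v (A v) := by
  have h2 := h0 (v - b⁻¹ • A v)
  have h3 := h1 (A v)
  have h4 : inner ℝ (v - b⁻¹ • A v) (A (v - b⁻¹ • A v))
      = inner ℝ v (A v) - 2 * b⁻¹ * ‖A v‖ ^ 2 + b⁻¹ ^ 2 * inner ℝ (A v) (A (A v)) := by
    have h5 : inner ℝ v (A (A v)) = ‖A v‖ ^ 2 := by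
      rw [← hA.inner_map, real_inner_self_eq_norm_sq]
    rw [map_sub, map_smul, inner_sub_left, inner_sub_right, inner_sub_right, real_inner_smul_left,
      real_inner_smul_left, real_inner_smul_right, real_inner_smul_right, h5,
      real_inner_self_eq_norm_sq]
    ring
  rw [h4] at h2
  have h6 : b⁻¹ ^ 2 * inner ℝ (A v) (A (A v)) ≤ b⁻¹ * ‖A v‖ ^ 2 :=
    (mul_le_mul_of_nonneg_left h3 (by positivity)).trans_eq (by field_simp)
  have h7 : b⁻¹ * ‖A v‖ ^ 2 ≤ inner ℝ v (A v) := by linarith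
  calc ‖A v‖ ^ 2 = b * (b⁻¹ * ‖A v‖ ^ 2) := by field_simp
    _ ≤ _ := mul_le_mul_of_nonneg_left h7 hb.le

lemma abs_inner_map_le {d : ℕ} (A : Op d) (u v : Vec d) :
    |inner ℝ u (A v)| ≤ ‖A‖ * ‖u‖ * ‖v‖ := by
  refine (abs_real_inner_le_norm _ _).trans ?_
  have := mul_le_mul_of_nonneg_left (A.le_opNorm v) (norm_nonneg u)
  linarith

namespace HessianBounds

variable {d : ℕ} {f : Vec d → ℝ} {lmin lmax L : ℝ}

lemma lmax_pos (hB : HessianBounds f lmin lmax L) : 0 < lmax := hB.lmin_pos.trans_le hB.le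

lemma inner_hess_nonneg (hB : HessianBounds f lmin lmax L) (x v : Vec d) :
    0 ≤ inner ℝ v (hess f x v) :=
  (mul_nonneg hB.lmin_pos.le (sq_nonneg _)).trans (hB.lower x v)

lemma hasGradientAt (hB : HessianBounds f lmin lmax L) (x : Vec d) :
    HasGradientAt f (gradient f x) x :=
  (hB.contDiff.differentiable (by norm_num) x).hasGradientAt

lemma hasFDerivAt_fderiv (hB : HessianBounds f lmin lmax L) (x : Vec d) :
    HasFDerivAt (fderiv ℝ f) (fderiv ℝ (fderiv ℝ f) x) x :=
  ((hB.contDiff.fderiv_right (m := 1) (by norm_num)).differentiable (by norm_num) x).hasFDerivAt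

lemma hasFDerivAt_gradient (hB : HessianBounds f lmin lmax L) (x : Vec d) :
    HasFDerivAt (gradient f) (hess f x) x := by
  have h : HasFDerivAt (gradient f) _ x :=
    (InnerProductSpace.toDual ℝ (Vec d)).symm.toContinuousLinearEquiv.toContinuousLinearMap
      |>.hasFDerivAt.comp x (hB.hasFDerivAt_fderiv x)
  exact h.differentiableAt.hasFDerivAt

lemma inner_hess (hB : HessianBounds f lmin lmax L) (x u v : Vec d) :
    inner ℝ (hess f x u) v = fderiv ℝ (fderiv ℝ f) x u v := by
  have h : HasFDerivAt (gradient f) _ x :=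
    (InnerProductSpace.toDual ℝ (Vec d)).symm.toContinuousLinearEquiv.toContinuousLinearMap
      |>.hasFDerivAt.comp x (hB.hasFDerivAt_fderiv x)
  rw [hess, h.fderiv]
  exact InnerProductSpace.toDual_symm_apply

lemma isSelfAdjoint_hess (hB : HessianBounds f lmin lmax L) (x : Vec d) :
    IsSelfAdjoint (hess f x) := by
  rw [ContinuousLinearMap.isSelfAdjoint_iff_isSymmetric]
  intro u v
  have hs : IsSymmSndFDerivAt ℝ f x :=
    hB.contDiff.contDiffAt.isSymmSndFDerivAt (by simp)
  change inner ℝ (hess f x u) v = inner ℝ u (hess f x v)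
  rw [hB.inner_hess, ← real_inner_comm, hB.inner_hess]
  exact hs.eq u v

lemma norm_hess_le (hB : HessianBounds f lmin lmax L) (x : Vec d) : ‖hess f x‖ ≤ lmax := by
  refine ContinuousLinearMap.opNorm_le_bound _ hB.lmax_pos.le fun v => ?_
  refine (abs_le_of_sq_le_sq' ?_ (mul_nonneg hB.lmax_pos.le (norm_nonneg _))).2
  refine ((hB.isSelfAdjoint_hess x).norm_map_sq_le hB.lmax_pos (hB.inner_hess_nonneg x)
    (hB.upper x) v).trans ?_
  rw [mul_pow, sq lmax, mul_assoc]
  exact mul_le_mul_of_nonneg_left (hB.upper x v) hB.lmax_pos.le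

lemma hasDerivAt_line (hB : HessianBounds f lmin lmax L) (x v : Vec d) (s : ℝ) :
    HasDerivAt (fun s : ℝ => f (x + s • v)) (inner ℝ (gradient f (x + s • v)) v) s := by
  have hl : HasDerivAt (fun s : ℝ => x + s • v) v s := by
    simpa using ((hasDerivAt_id s).smul_const v).const_add x
  have := (hB.hasGradientAt (x + s • v)).hasFDerivAt.comp_hasDerivAt s hl
  exact this.congr_deriv InnerProductSpace.toDual_apply_apply

lemma hasDerivAt_line_gradient (hB : HessianBounds f lmin lmax L) (x v : Vec d) (s : ℝ) :
    HasDerivAt (fun s : ℝ => inner ℝ (gradient f (x + s • v)) v)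
      (inner ℝ v (hess f (x + s • v) v)) s := by
  have hl : HasDerivAt (fun s : ℝ => x + s • v) v s := by
    simpa using ((hasDerivAt_id s).smul_const v).const_add x
  have h1 := (hB.hasFDerivAt_gradient (x + s • v)).comp_hasDerivAt s hl
  have h2 := h1.inner ℝ (hasDerivAt_const s v)
  simpa [real_inner_comm] using h2

lemma le_taylor (hB : HessianBounds f lmin lmax L) (x v : Vec d) {m : ℝ}
    (hm : ∀ s ∈ Set.Icc (0 : ℝ) 1, inner ℝ v (hess f (x + s • v) v) ≤ m) :
    f (x + v) ≤ f x + inner ℝ (gradient f x) v + m / 2 := by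
  simpa using le_taylor_two_of_deriv_le (hB.hasDerivAt_line x v)
    (hB.hasDerivAt_line_gradient x v) hm

lemma taylor_le (hB : HessianBounds f lmin lmax L) (x v : Vec d) {m : ℝ}
    (hm : ∀ s ∈ Set.Icc (0 : ℝ) 1, m ≤ inner ℝ v (hess f (x + s • v) v)) :
    f x + inner ℝ (gradient f x) v + m / 2 ≤ f (x + v) := by
  have := le_taylor_two_of_deriv_le (m := -m) (fun s => (hB.hasDerivAt_line x v s).neg)
    (fun s => (hB.hasDerivAt_line_gradient x v s).neg) (fun s hs => neg_le_neg (hm s hs))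
  simp only [zero_smul, one_smul, add_zero, Pi.neg_apply] at this
  linarith

lemma gradient_eq_zero {xs : Vec d} (hxs : ∀ x, f xs ≤ f x) : gradient f xs = 0 := by
  have : IsLocalMin f xs := Filter.Eventually.of_forall hxs
  rw [gradient, this.fderiv_eq_zero, map_zero]

lemma strong_convexity (hB : HessianBounds f lmin lmax L) {xs : Vec d} (hxs : ∀ x, f xs ≤ f x)
    (x : Vec d) : lmin * ‖x - xs‖ ^ 2 ≤ 2 * (f x - f xs) := by
  have := hB.taylor_le xs (x - xs) fun s _ => hB.lower (xs + s • (x - xs)) (x - xs)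
  rw [gradient_eq_zero hxs, inner_zero_left, add_sub_cancel] at this
  linarith

/-- The Polyak–Łojasiewicz inequality. -/
lemma gap_le_norm_gradient_sq (hB : HessianBounds f lmin lmax L) (xs x : Vec d) :
    2 * lmin * (f x - f xs) ≤ ‖gradient f x‖ ^ 2 := by
  have h1 := hB.taylor_le x (xs - x) fun s _ => hB.lower (x + s • (xs - x)) (xs - x)
  rw [add_sub_cancel] at h1
  have h2 := neg_le_of_abs_le (abs_real_inner_le_norm (gradient f x) (xs - x))
  have h3 := hB.lmin_pos
  nlinarith [sq_nonneg (lmin * ‖xs - x‖ - ‖gradient f x‖)]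

lemma norm_gradient_sub_le (hB : HessianBounds f lmin lmax L) {xs : Vec d}
    (hxs : ∀ x, f xs ≤ f x) (x : Vec d) :
    ‖gradient f x - hess f xs (x - xs)‖ ≤ L * ‖x - xs‖ * ‖x - xs‖ := by
  have h := (convex_segment xs x).norm_image_sub_le_of_norm_hasFDerivWithin_le'
    (f := gradient f) (φ := hess f xs) (C := L * ‖x - xs‖)
    (fun y _ => (hB.hasFDerivAt_gradient y).hasFDerivWithinAt)
    (fun y hy => (hB.lip y xs).trans (mul_le_mul_of_nonneg_left (by
      rw [← dist_eq_norm, ← dist_eq_norm, dist_comm, dist_comm x]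
      have := dist_add_dist_of_mem_segment hy
      have := dist_nonneg (x := y) (y := x)
      linarith) hB.L_pos.le))
    (left_mem_segment ℝ xs x) (right_mem_segment ℝ xs x)
  rwa [gradient_eq_zero hxs, sub_zero] at h

/-! ### The norm induced by the Hessian -/

lemma matNorm_sq (hB : HessianBounds f lmin lmax L) (xs v : Vec d) :
    matNorm (hess f xs) v ^ 2 = inner ℝ v (hess f xs v) :=
  Real.sq_sqrt (hB.inner_hess_nonneg xs v)

lemma lower_matNorm (hB : HessianBounds f lmin lmax L) (xs v : Vec d) :
    √lmin * ‖v‖ ≤ matNorm (hess f xs) v := by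
  refine Real.le_sqrt_of_sq_le ?_
  rw [mul_pow, Real.sq_sqrt hB.lmin_pos.le]
  exact hB.lower xs v

lemma mul_norm_mul_norm_le_matNorm (hB : HessianBounds f lmin lmax L) (xs u v : Vec d) :
    lmin * (‖u‖ * ‖v‖) ≤ matNorm (hess f xs) u * matNorm (hess f xs) v := by
  have := mul_le_mul (hB.lower_matNorm xs u) (hB.lower_matNorm xs v) (by positivity)
    (Real.sqrt_nonneg _)
  refine le_trans (le_of_eq ?_) this
  rw [show √lmin * ‖u‖ * (√lmin * ‖v‖) = √lmin ^ 2 * (‖u‖ * ‖v‖) by ring,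
    Real.sq_sqrt hB.lmin_pos.le]

lemma norm_le_of_matNorm_le (hB : HessianBounds f lmin lmax L) {xs v : Vec d} {r : ℝ}
    (h : L * matNorm (hess f xs) v ≤ r * lmin ^ (3 / 2 : ℝ)) : L * ‖v‖ ≤ r * lmin := by
  have hs : 0 < √lmin := Real.sqrt_pos.2 hB.lmin_pos
  have h1 : lmin ^ (3 / 2 : ℝ) = lmin * √lmin := by
    rw [Real.sqrt_eq_rpow, show (3 / 2 : ℝ) = 1 + 1 / 2 by norm_num, Real.rpow_add hB.lmin_pos,
      Real.rpow_one]
  rw [h1] at h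
  have h2 := mul_le_mul_of_nonneg_left (hB.lower_matNorm xs v) hB.L_pos.le
  refine le_of_mul_le_mul_right ?_ hs
  linarith

/-- Near the minimizer the objective gap controls the distance in the Hessian norm. -/
lemma matNorm_sq_le_gap (hB : HessianBounds f lmin lmax L) {xs : Vec d} (hxs : ∀ x, f xs ≤ f x)
    {x : Vec d} (hx : L * ‖x - xs‖ ≤ 1 / 3 * lmin) :
    matNorm (hess f xs) (x - xs) ^ 2 ≤ 3 * (f x - f xs) := by
  set v := x - xs with hv
  have h1 : ∀ s ∈ Set.Icc (0 : ℝ) 1,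
      2 / 3 * inner ℝ v (hess f xs v) ≤ inner ℝ v (hess f (xs + s • v) v) := by
    intro s hs
    have h2 := abs_inner_map_le (hess f (xs + s • v) - hess f xs) v v
    have h3 := hB.lip (xs + s • v) xs
    have h4 : L * ‖xs + s • v - xs‖ ≤ 1 / 3 * lmin := by
      rw [add_sub_cancel_left, norm_smul, Real.norm_of_nonneg hs.1]
      refine le_trans ?_ hx
      have := mul_le_of_le_one_left (norm_nonneg v) hs.2
      exact mul_le_mul_of_nonneg_left this hB.L_pos.le
    have h5 : ‖hess f (xs + s • v) - hess f xs‖ * ‖v‖ * ‖v‖ ≤ 1 / 3 * (lmin * ‖v‖ ^ 2) := by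
      calc _ ≤ (1 / 3 * lmin) * ‖v‖ * ‖v‖ := by gcongr; exact h3.trans h4
        _ = _ := by ring
    have h6 := hB.lower xs v
    rw [sub_apply, inner_sub_right] at h2
    have h7 := (abs_le.1 h2).1
    linarith
  have h8 := hB.taylor_le xs v h1
  rw [gradient_eq_zero hxs, inner_zero_left, hv, add_sub_cancel] at h8
  rw [hB.matNorm_sq]
  linarith

end HessianBounds

/-! ### One step of the line-search Newton iteration -/

lemma IsNewtonStep.apply_le {d : ℕ} {f : Vec d → ℝ} {β ρ : ℝ} {A : Op d} {x x' : Vec d}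
    (h : IsNewtonStep f β ρ A x x') (hβ : 0 < β) (hρ : 0 < ρ) : f x' ≤ f x := by
  rcases h with ⟨-, rfl⟩ | ⟨p, -, ⟨-, rfl⟩ | ⟨hp, j, hj, rfl⟩⟩
  · exact le_rfl
  · exact le_rfl
  · refine (hj.1).trans ?_
    have : ρ ^ j * β * inner ℝ (gradient f x) p ≤ 0 :=
      mul_nonpos_of_nonneg_of_nonpos (by positivity) hp.le
    linarith

namespace HessianBounds

variable {d : ℕ} {f : Vec d → ℝ} {lmin lmax L β ρ : ℝ} {A : Op d} {x x' xs : Vec d}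

/-- With a matrix whose spectrum lies in `[(1 - ε) lmin, (1 + ε) lmax]`, one step contracts the
objective gap by `1 - φ`. Backtracking yields a step length of at least `min 1 (2 ρ (1 - β) u)`,
where `u = (1 - ε) / κ`. -/
lemma gap_newtonStep_le (hB : HessianBounds f lmin lmax L) (hβ : 0 < β ∧ β < 1 / 2)
    (hρ : 0 < ρ ∧ ρ < 1) {ε : ℝ} (hε : 0 < ε ∧ ε < 1) (hA : IsSelfAdjoint A)
    (hlo : ∀ v, (1 - ε) * lmin * ‖v‖ ^ 2 ≤ inner ℝ v (A v))
    (hup : ∀ v, inner ℝ v (A v) ≤ (1 + ε) * lmax * ‖v‖ ^ 2)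
    (hxs : ∀ x, f xs ≤ f x) (h : IsNewtonStep f β ρ A x x') :
    f x' - f xs ≤ (1 - linRate β ρ ε (lmax / lmin)) * (f x - f xs) := by
  obtain ⟨hβ0, hβ1⟩ := hβ
  obtain ⟨hρ0, hρ1⟩ := hρ
  obtain ⟨hε0, hε1⟩ := hε
  have hm := hB.lmin_pos
  have hM := hB.lmax_pos
  have hc : 0 < (1 - ε) * lmin := mul_pos (by linarith) hm
  rcases h with ⟨hno, -⟩ | ⟨p, hAp, hstep⟩
  · exact absurd (exists_apply_eq_of_coercive hc hlo _) hno
  have hg : gradient f x = -A p := by rw [hAp, neg_neg]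
  set q := inner ℝ p (A p) with hq
  have hgp : inner ℝ (gradient f x) p = -q := by
    rw [hg, inner_neg_left, real_inner_comm]
  have hgap := hB.gap_le_norm_gradient_sq xs x
  have hgsq : ‖gradient f x‖ ^ 2 ≤ (1 + ε) * lmax * q := by
    rw [hg, norm_neg]
    exact hA.norm_map_sq_le (by positivity)
      (fun v => (mul_nonneg hc.le (sq_nonneg _)).trans (hlo v)) hup p
  rcases hstep with ⟨hp, rfl⟩ | ⟨hp, j, hj, rfl⟩
  · -- A direction without descent forces a vanishing gradient, so that `x` is the minimizer.
    rw [hgp] at hp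
    have h1 : (1 + ε) * lmax * q ≤ 0 :=
      mul_nonpos_of_nonneg_of_nonpos (by positivity) (by linarith)
    have h2 : f x' - f xs ≤ 0 := by
      by_contra! h
      have : 0 < 2 * lmin * (f x' - f xs) := by positivity
      linarith
    have h3 : f x' - f xs = 0 := le_antisymm h2 (sub_nonneg.2 (hxs x'))
    rw [h3]; simp
  have hq0 : 0 < q := by linarith
  set u := (1 - ε) * lmin / lmax with hu
  have hu0 : 0 < u := by positivity
  have hu1 : u ≤ 1 := by
    rw [hu, div_le_one hM]
    nlinarith [hB.le]
  have hpsq : lmax * ‖p‖ ^ 2 ≤ q / u := by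
    rw [le_div_iff₀ hu0, hu]
    calc lmax * ‖p‖ ^ 2 * ((1 - ε) * lmin / lmax) = (1 - ε) * lmin * ‖p‖ ^ 2 := by field_simp
      _ ≤ q := hlo p
  have hdescent : ∀ μ : ℝ, f (x + μ • p) ≤ f x - μ * q * (1 - μ / (2 * u)) := by
    intro μ
    have h1 := hB.le_taylor x (μ • p) fun s _ => hB.upper (x + s • μ • p) (μ • p)
    rw [real_inner_smul_right, hgp, norm_smul, mul_pow, Real.norm_eq_abs, sq_abs] at h1
    have h2 := mul_le_mul_of_nonneg_left hpsq (sq_nonneg μ)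
    have h3 : μ * q * (1 - μ / (2 * u)) = μ * q - μ ^ 2 * (q / u) / 2 := by field_simp
    rw [h3]; linarith
  have hkey : f (x + ρ ^ j • p) ≤ f x - 2 * ρ * β * (1 - β) * u * q := by
    have harm : f (x + ρ ^ j • p) ≤ f x - ρ ^ j * β * q := by
      have := hj.1
      simp only [Set.mem_ofPred_eq, hgp] at this
      linarith
    rcases j with _ | k
    · simp only [pow_zero] at harm ⊢
      rcases le_total (2 * (1 - β) * u) 1 with h1 | h1
      · refine harm.trans ?_
        have h3 : ρ * (2 * (1 - β) * u) ≤ 1 := mul_le_one₀ hρ1.le (by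
          have : 0 < 1 - β := by linarith
          positivity) h1
        have h2 : 2 * ρ * β * (1 - β) * u ≤ 1 * β := by
          nlinarith
        have := mul_le_mul_of_nonneg_right h2 hq0.le
        linarith
      · -- Here the Armijo inequality is too weak, and the descent lemma is used instead.
        refine (hdescent 1).trans ?_
        have h2 : 0 ≤ (2 * (1 - β) * u - 1) * (1 - 2 * β * u) :=
          mul_nonneg (by linarith) (by nlinarith)
        have h3 : 2 * β * (1 - β) * u ≤ 1 - 1 / (2 * u) := by
          rw [le_sub_iff_add_le, ← sub_nonneg]
          have : 1 - (2 * β * (1 - β) * u + 1 / (2 * u))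
              = (2 * (1 - β) * u - 1) * (1 - 2 * β * u) / (2 * u) := by field_simp; ring
          rw [this]; positivity
        have h4 : 2 * ρ * β * (1 - β) * u ≤ 2 * β * (1 - β) * u := by
          have : 0 ≤ 2 * β * (1 - β) * u := by
            have : 0 < 1 - β := by linarith
            positivity
          nlinarith
        have := mul_le_mul_of_nonneg_right (h4.trans h3) hq0.le
        linarith
    · have hk : ¬ f (x + ρ ^ k • p) ≤ f x + ρ ^ k * β * inner ℝ (gradient f x) p := fun hk => by
        have := hj.2 hk
        omega
      have h1 : 2 * (1 - β) * u ≤ ρ ^ k := by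
        by_contra! h1
        refine hk ((hdescent _).trans ?_)
        rw [hgp]
        have h2 : β ≤ 1 - ρ ^ k / (2 * u) := by
          rw [le_sub_comm, div_le_iff₀ (by positivity)]
          linarith
        have := mul_le_mul_of_nonneg_left h2 (by positivity : 0 ≤ ρ ^ k * q)
        linarith
      refine harm.trans ?_
      have h2 := mul_le_mul_of_nonneg_left h1 (by positivity : 0 ≤ ρ * β * q)
      rw [pow_succ]
      linarith
  have hqgap : 2 * lmin / ((1 + ε) * lmax) * (f x - f xs) ≤ q := by
    rw [div_mul_eq_mul_div, div_le_iff₀ (by positivity)]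
    linarith
  have h1 : 0 ≤ 2 * ρ * β * (1 - β) * u := by
    have : 0 < 1 - β := by linarith
    positivity
  have h2 := mul_le_mul_of_nonneg_left hqgap h1
  have h3 : linRate β ρ ε (lmax / lmin) * (f x - f xs)
      = 2 * ρ * β * (1 - β) * u * (2 * lmin / ((1 + ε) * lmax) * (f x - f xs)) := by
    rw [linRate, hu]; field_simp; ring
  linarith

/-- A full Newton step near the minimizer, with a matrix close to the Hessian at the minimizer. -/
lemma matNorm_newton_le (hB : HessianBounds f lmin lmax L) (hxs : ∀ x, f xs ≤ f x) {η r : ℝ}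
    (hη1 : η < 1) (hA : ‖A - hess f xs‖ ≤ η * lmin) (hr : L * ‖x - xs‖ ≤ r * lmin) {p : Vec d}
    (hp : A p = -gradient f x) :
    matNorm (hess f xs) (x + p - xs) ≤ (r + η) / (1 - η) * matNorm (hess f xs) (x - xs) := by
  set v := x - xs with hv
  set e := x + p - xs with he
  have hev : e = v + p := by rw [he, hv]; abel
  have hm := hB.lmin_pos
  have hη : 0 < 1 - η := by linarith
  have h1 : A e = (hess f xs v - gradient f x) + (A - hess f xs) v := by
    rw [hev, map_add, hp, sub_apply]; abel
  have h2 : inner ℝ e (A e) ≤ (r + η) * (lmin * (‖e‖ * ‖v‖)) := by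
    rw [h1, inner_add_right]
    have h3 : inner ℝ e (hess f xs v - gradient f x) ≤ r * (lmin * (‖e‖ * ‖v‖)) := by
      refine (real_inner_le_norm _ _).trans ?_
      rw [norm_sub_rev (hess f xs v)]
      calc ‖e‖ * ‖gradient f x - hess f xs v‖ ≤ ‖e‖ * (r * lmin * ‖v‖) := by
            refine mul_le_mul_of_nonneg_left ?_ (norm_nonneg _)
            exact (hB.norm_gradient_sub_le hxs x).trans
              (mul_le_mul_of_nonneg_right hr (norm_nonneg _))
        _ = _ := by ring
    have h4 : inner ℝ e ((A - hess f xs) v) ≤ η * (lmin * (‖e‖ * ‖v‖)) := by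
      refine (le_abs_self _).trans ((abs_inner_map_le _ _ _).trans ?_)
      calc ‖A - hess f xs‖ * ‖e‖ * ‖v‖ ≤ η * lmin * ‖e‖ * ‖v‖ := by gcongr
        _ = _ := by ring
    linarith
  have hnn : 0 ≤ r + η := by
    have h3 : 0 ≤ r * lmin := (mul_nonneg hB.L_pos.le (norm_nonneg _)).trans hr
    have h4 : 0 ≤ η * lmin := (norm_nonneg _).trans hA
    exact add_nonneg (nonneg_of_mul_nonneg_left h3 hm) (nonneg_of_mul_nonneg_left h4 hm)
  have h5 : (1 - η) * matNorm (hess f xs) e ^ 2 ≤ inner ℝ e (A e) := by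
    have h6 := (abs_le.1 (abs_inner_map_le (A - hess f xs) e e)).1
    rw [sub_apply, inner_sub_right, ← hB.matNorm_sq] at h6
    have h7 : ‖A - hess f xs‖ * ‖e‖ * ‖e‖ ≤ η * matNorm (hess f xs) e ^ 2 := by
      have h8 := hB.mul_norm_mul_norm_le_matNorm xs e e
      have h9 : 0 ≤ η := nonneg_of_mul_nonneg_left ((norm_nonneg _).trans hA) hm
      calc ‖A - hess f xs‖ * ‖e‖ * ‖e‖ ≤ η * lmin * ‖e‖ * ‖e‖ := by gcongr
        _ = η * (lmin * (‖e‖ * ‖e‖)) := by ring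
        _ ≤ η * (matNorm (hess f xs) e * matNorm (hess f xs) e) := by gcongr
        _ = _ := by ring
    linarith
  have h10 := mul_le_mul_of_nonneg_left (hB.mul_norm_mul_norm_le_matNorm xs e v) hnn
  have h11 : 0 ≤ matNorm (hess f xs) e := Real.sqrt_nonneg _
  have h12 : 0 ≤ matNorm (hess f xs) v := Real.sqrt_nonneg _
  rw [div_mul_eq_mul_div, le_div_iff₀ hη]
  rcases h11.eq_or_lt with h0 | h0
  · rw [← h0]; simp only [zero_mul]; positivity
  · refine le_of_mul_le_mul_right ?_ h0
    linarith

/-- Near the minimizer, and with a matrix close to the Hessian at the minimizer, the line search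
accepts the full step, so that the bound of `matNorm_newton_le` holds for the iteration. -/
lemma matNorm_newtonStep_le (hB : HessianBounds f lmin lmax L) (hxs : ∀ x, f xs ≤ f x) {η r ν : ℝ}
    (hβ : β < 1) (hη1 : η < 1) (hA : ‖A - hess f xs‖ ≤ η * lmin)
    (hr : L * matNorm (hess f xs) (x - xs) ≤ r * lmin ^ (3 / 2 : ℝ)) (hrν : r ≤ ν)
    (hcontr : (r + η) / (1 - η) ≤ 1) (harm : (1 + ν) / 2 ≤ (1 - β) * (1 - η))
    (h : IsNewtonStep f β ρ A x x') :
    matNorm (hess f xs) (x' - xs) ≤ (r + η) / (1 - η) * matNorm (hess f xs) (x - xs) := by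
  have hm := hB.lmin_pos
  have hη0 : 0 ≤ η := nonneg_of_mul_nonneg_left ((norm_nonneg _).trans hA) hm
  have hη : 0 < 1 - η := by linarith
  have hv0 : 0 ≤ matNorm (hess f xs) (x - xs) := Real.sqrt_nonneg _
  have hquad : ∀ v, (1 - η) * matNorm (hess f xs) v ^ 2 ≤ inner ℝ v (A v) := by
    intro v
    have h6 := (abs_le.1 (abs_inner_map_le (A - hess f xs) v v)).1
    rw [sub_apply, inner_sub_right, ← hB.matNorm_sq] at h6
    have h7 : ‖A - hess f xs‖ * ‖v‖ * ‖v‖ ≤ η * matNorm (hess f xs) v ^ 2 := by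
      have h8 := hB.mul_norm_mul_norm_le_matNorm xs v v
      calc ‖A - hess f xs‖ * ‖v‖ * ‖v‖ ≤ η * lmin * ‖v‖ * ‖v‖ := by gcongr
        _ = η * (lmin * (‖v‖ * ‖v‖)) := by ring
        _ ≤ η * (matNorm (hess f xs) v * matNorm (hess f xs) v) := by gcongr
        _ = _ := by ring
    linarith
  have hcoer : ∀ v, (1 - η) * lmin * ‖v‖ ^ 2 ≤ inner ℝ v (A v) := by
    intro v
    refine le_trans ?_ (hquad v)
    rw [hB.matNorm_sq, mul_assoc]
    exact mul_le_mul_of_nonneg_left (hB.lower xs v) hη.le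
  rcases h with ⟨hno, -⟩ | ⟨p, hAp, hstep⟩
  · exact absurd (exists_apply_eq_of_coercive (by positivity) hcoer _) hno
  have hnew := hB.matNorm_newton_le hxs hη1 hA (hB.norm_le_of_matNorm_le hr) hAp
  have hg : gradient f x = -A p := by rw [hAp, neg_neg]
  have hgp : inner ℝ (gradient f x) p = -inner ℝ p (A p) := by
    rw [hg, inner_neg_left, real_inner_comm]
  rcases hstep with ⟨hp, rfl⟩ | ⟨hp, j, hj, rfl⟩
  · have h1 := hcoer p
    have h2 : ‖p‖ ^ 2 ≤ 0 := by
      by_contra! hc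
      have : 0 < (1 - η) * lmin * ‖p‖ ^ 2 := by positivity
      linarith
    have h3 : p = 0 :=
      norm_eq_zero.1 (pow_eq_zero_iff (two_ne_zero) |>.1 (le_antisymm h2 (sq_nonneg _)))
    rwa [h3, add_zero] at hnew
  have hr' : L * matNorm (hess f xs) (x + p - xs) ≤ ν * lmin ^ (3 / 2 : ℝ) := by
    refine le_trans ?_ (hr.trans (mul_le_mul_of_nonneg_right hrν (by positivity)))
    exact mul_le_mul_of_nonneg_left
      (hnew.trans (mul_le_of_le_one_left hv0 hcontr)) hB.L_pos.le
  have hd0 : L * ‖x - xs‖ ≤ ν * lmin :=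
    hB.norm_le_of_matNorm_le (hr.trans (mul_le_mul_of_nonneg_right hrν (by positivity)))
  have hd1 : L * ‖x + p - xs‖ ≤ ν * lmin := hB.norm_le_of_matNorm_le hr'
  have hunit : f (x + p) ≤ f x + β * inner ℝ (gradient f x) p := by
    have h1 : ∀ s ∈ Set.Icc (0 : ℝ) 1, inner ℝ p (hess f (x + s • p) p)
        ≤ (1 + ν) * matNorm (hess f xs) p ^ 2 := by
      intro s hs
      have h2 := (abs_le.1 (abs_inner_map_le (hess f (x + s • p) - hess f xs) p p)).2
      rw [sub_apply, inner_sub_right, ← hB.matNorm_sq xs p] at h2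
      have h3 : L * ‖x + s • p - xs‖ ≤ ν * lmin := by
        have h4 : x + s • p - xs = (1 - s) • (x - xs) + s • (x + p - xs) := by
          module
        have h5 : ‖x + s • p - xs‖ ≤ (1 - s) * ‖x - xs‖ + s * ‖x + p - xs‖ := by
          rw [h4]
          refine (norm_add_le _ _).trans_eq ?_
          rw [norm_smul, norm_smul, Real.norm_of_nonneg (by linarith [hs.2]),
            Real.norm_of_nonneg hs.1]
        have h6 := mul_le_mul_of_nonneg_left h5 hB.L_pos.le
        have h7 := mul_le_mul_of_nonneg_left hd0 (by linarith [hs.2] : 0 ≤ 1 - s)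
        have h8 := mul_le_mul_of_nonneg_left hd1 hs.1
        linarith
      have hν0 : 0 ≤ ν :=
        nonneg_of_mul_nonneg_left ((mul_nonneg hB.L_pos.le (norm_nonneg _)).trans hd0) hm
      have h9 : ‖hess f (x + s • p) - hess f xs‖ * ‖p‖ * ‖p‖ ≤ ν * matNorm (hess f xs) p ^ 2 := by
        have h8 := hB.mul_norm_mul_norm_le_matNorm xs p p
        calc _ ≤ ν * lmin * ‖p‖ * ‖p‖ := by gcongr; exact (hB.lip _ _).trans h3
          _ = ν * (lmin * (‖p‖ * ‖p‖)) := by ring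
          _ ≤ ν * (matNorm (hess f xs) p * matNorm (hess f xs) p) := by gcongr
          _ = _ := by ring
      linarith
    have h10 := hB.le_taylor x p h1
    have h11 := mul_le_mul_of_nonneg_left (hquad p) (by linarith : 0 ≤ 1 - β)
    have h12 := mul_le_mul_of_nonneg_right harm (sq_nonneg (matNorm (hess f xs) p))
    rw [hgp] at h10 ⊢
    linarith
  have hj0 : j = 0 := by
    have : j ≤ 0 := hj.2 (by simpa using hunit)
    omega
  subst hj0
  simpa using hnew

end HessianBounds

/-! ### Averages, rates and times -/

/-- With uniform weights the online average is the arithmetic mean. -/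
lemma hessAvg_uniformWeights {V : Type*} [AddCommGroup V] [Module ℝ V] (H : ℕ → V) (t : ℕ) :
    hessAvg uniformWeights H t = ((t : ℝ) + 1)⁻¹ • ∑ i ∈ Finset.range (t + 1), H i := by
  induction t with
  | zero => simp [hessAvg, uniformWeights]
  | succ t ih =>
    have h1 : (t : ℝ) + 1 ≠ 0 := by positivity
    have h2 : (t : ℝ) + 1 + 1 ≠ 0 := by positivity
    rw [hessAvg, ih, Finset.sum_range_succ _ (t + 1), smul_add, smul_smul]
    simp only [uniformWeights]
    push_cast
    congr 2
    · field_simp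
    · field_simp; ring

lemma sum_range_le_of_le {h : ℕ → ℝ} {a b : ℝ} (hb0 : 0 ≤ b) {k : ℕ} (ha : ∀ i, h i ≤ a)
    (ha0 : 0 ≤ a) (hb : ∀ i, k ≤ i → h i ≤ b) (n : ℕ) :
    ∑ i ∈ Finset.range n, h i ≤ k * a + n * b := by
  have h1 : ∀ i, h i ≤ (if i < k then a else 0) + b := by
    intro i
    split_ifs with hi
    · linarith [ha i]
    · linarith [hb i (not_lt.1 hi)]
  refine (Finset.sum_le_sum fun i _ => h1 i).trans ?_
  rw [Finset.sum_add_distrib, Finset.sum_const, Finset.card_range, nsmul_eq_mul,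
    ← Finset.sum_filter, Finset.sum_const, nsmul_eq_mul]
  have h2 : ((Finset.range n).filter (· < k)).card ≤ k := by
    refine (Finset.card_le_card (t := Finset.range k) fun i hi => ?_).trans_eq (Finset.card_range k)
    simpa using (Finset.mem_filter.1 hi).2
  have h3 : (((Finset.range n).filter (· < k)).card : ℝ) ≤ k := by exact_mod_cast h2
  have := mul_le_mul_of_nonneg_right h3 ha0
  linarith

/-- A sequence halved in every step from `m` on is summable from `m` on, and decays at least
like `1 / (s + 1)`. -/
lemma halving_bounds {r : ℕ → ℝ} {ν : ℝ} {m : ℕ} (hν : 0 ≤ ν) (h0 : r m ≤ ν)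
    (hr : ∀ s, m ≤ s → r (s + 1) ≤ 1 / 2 * r s) {s : ℕ} (hs : m ≤ s) :
    ∑ i ∈ Finset.Ico m (s + 1), r i + r s ≤ 2 * ν ∧ r s * (s + 1) ≤ ν * (m + 1) := by
  induction s, hs using Nat.le_induction with
  | base =>
    refine ⟨?_, by gcongr⟩
    rw [Nat.Ico_succ_singleton, Finset.sum_singleton]
    linarith
  | succ s hs ih =>
    have h1 := hr s hs
    refine ⟨?_, ?_⟩
    · rw [Finset.sum_Ico_succ_top (by omega)]
      linarith [ih.1]
    · push_cast
      have h2 : (0 : ℝ) ≤ s := s.cast_nonneg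
      have h3 : 0 ≤ ν * (m + 1) := by positivity
      nlinarith [mul_le_mul_of_nonneg_right h1 (by positivity : (0 : ℝ) ≤ s + 1 + 1), ih.2]

lemma linRate_pos_lt_one {β ρ ε κ : ℝ} (hβ : 0 < β ∧ β < 1 / 2) (hρ : 0 < ρ ∧ ρ < 1)
    (hε : 0 < ε ∧ ε < 1) (hκ : 1 ≤ κ) : 0 < linRate β ρ ε κ ∧ linRate β ρ ε κ < 1 := by
  obtain ⟨hβ0, hβ1⟩ := hβ
  obtain ⟨hρ0, hρ1⟩ := hρ
  obtain ⟨hε0, hε1⟩ := hε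
  have hb : 0 < 1 - β := by linarith
  have he : 0 < 1 - ε := by linarith
  refine ⟨by unfold linRate; positivity, ?_⟩
  unfold linRate
  rw [div_lt_one (by positivity)]
  have h1 : 4 * β * (1 - β) ≤ 1 := by nlinarith [sq_nonneg (2 * β - 1)]
  have h2 : 4 * β * (1 - β) * ρ < 1 := by
    have : 0 < 4 * β * (1 - β) := by positivity
    nlinarith
  calc 4 * ρ * β * (1 - β) * (1 - ε) = (4 * β * (1 - β) * ρ) * (1 - ε) := by ring
    _ < 1 * (1 - ε) := by gcongr
    _ ≤ 1 ^ 2 * (1 + ε) := by linarith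
    _ ≤ κ ^ 2 * (1 + ε) := by gcongr

section Times

variable {d : ℕ} {δ ε Υ : ℝ}

lemma four_le_timeOne (hdδ : Real.exp 1 ≤ d / δ) : 4 ≤ timeOne d δ ε Υ := by
  unfold timeOne
  set M := max 1 (8 * Υ / ε) with hM
  have hM1 : 1 ≤ M := le_max_left _ _
  have h1 : Real.exp 1 ≤ d / δ * M := by nlinarith [Real.exp_pos 1]
  have h2 : 1 ≤ Real.log (d / δ * M) :=
    (Real.le_log_iff_exp_le ((Real.exp_pos 1).trans_le h1)).2 h1
  have h3 : 1 ≤ M ^ 2 := one_le_pow₀ hM1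
  nlinarith

/-- From `𝒯₁` on, the number of samples dominates the logarithm in the concentration bound. -/
lemma sq_mul_log_le_of_timeOne_le (hdδ : Real.exp 1 ≤ d / δ) {n : ℝ}
    (hn : timeOne d δ ε Υ ≤ n) : (max 1 (8 * Υ / ε)) ^ 2 * Real.log (d * n / δ) ≤ n := by
  unfold timeOne at hn
  set M := max 1 (8 * Υ / ε) with hM
  have hM1 : 1 ≤ M := le_max_left _ _
  have hM0 : 0 < M := by linarith
  set D := (d : ℝ) / δ with hD
  have hD1 : 1 ≤ D := by linarith [Real.add_one_le_exp (1 : ℝ)]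
  have hD0 : 0 < D := by linarith
  have h1 : Real.exp 1 ≤ D * M := by nlinarith [Real.exp_pos 1]
  have h2 : 1 ≤ Real.log (D * M) :=
    (Real.le_log_iff_exp_le ((Real.exp_pos 1).trans_le h1)).2 h1
  set y := n / M ^ 2 with hy
  have hny : n = y * M ^ 2 := by rw [hy]; field_simp
  have hy4 : 4 * Real.log (D * M) ≤ y := by
    rw [hy, le_div_iff₀ (by positivity)]; linarith
  have hy0 : 0 < y := by linarith
  have h3 : Real.log y ≤ y / 2 := by
    have h4 := Real.log_le_sub_one_of_pos (show 0 < y / 2 by positivity)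
    rw [Real.log_div hy0.ne' two_ne_zero] at h4
    have := Real.log_two_lt_d9
    linarith
  have h5 : Real.log (d * n / δ) ≤ y := by
    have h6 : d * n / δ = D * M ^ 2 * y := by rw [hD, hny]; ring
    have h7 : D * M ^ 2 ≤ (D * M) ^ 2 := by
      rw [mul_pow]
      have : D ≤ D ^ 2 := by nlinarith
      gcongr
    have h8 := Real.log_le_log (by positivity) h7
    rw [Real.log_pow] at h8
    rw [h6, Real.log_mul (by positivity) hy0.ne']
    push_cast at h8
    linarith
  calc M ^ 2 * Real.log (d * n / δ) ≤ M ^ 2 * y := by gcongr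
    _ = n := by rw [hny]; ring

lemma log_le_of_timeOne_le (hdδ : Real.exp 1 ≤ d / δ) {n : ℝ}
    (hn : timeOne d δ ε Υ ≤ n) : Real.log (d * n / δ) ≤ n := by
  have h1 := sq_mul_log_le_of_timeOne_le hdδ hn
  have h0 : 0 ≤ n := by linarith [four_le_timeOne (ε := ε) (Υ := Υ) hdδ]
  have h2 : 1 ≤ (max 1 (8 * Υ / ε)) ^ 2 := one_le_pow₀ (le_max_left _ _)
  rcases le_total (Real.log (d * n / δ)) 0 with h | h
  · exact h.trans h0
  · nlinarith

lemma noise_rate_le_of_timeOne_le (hdδ : Real.exp 1 ≤ d / δ) (hε : 0 < ε) {n : ℝ}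
    (hn : timeOne d δ ε Υ ≤ n) : 8 * Υ * √(Real.log (d * n / δ) / n) ≤ ε := by
  have h1 := sq_mul_log_le_of_timeOne_le hdδ hn
  have hn0 : 0 < n := by linarith [four_le_timeOne (ε := ε) (Υ := Υ) hdδ]
  set M := max 1 (8 * Υ / ε) with hM
  have hM1 : 1 ≤ M := le_max_left _ _
  have hM0 : 0 < M := by linarith
  have h2 : √(Real.log (d * n / δ) / n) ≤ 1 / M := by
    rw [Real.sqrt_le_left (by positivity), div_pow, one_pow, div_le_div_iff₀ hn0 (by positivity)]
    linarith
  have h3 : 8 * Υ ≤ M * ε := (div_le_iff₀ hε).1 (le_max_right _ _)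
  calc 8 * Υ * √(Real.log (d * n / δ) / n) ≤ M * ε * √(Real.log (d * n / δ) / n) := by gcongr
    _ ≤ M * ε * (1 / M) := by gcongr
    _ = ε := by field_simp

lemma tendsto_superRate (d : ℕ) (δ Υ κ T : ℝ) :
    Filter.Tendsto (superRate d δ Υ κ T) Filter.atTop (nhds 0) := by
  have hcast : Filter.Tendsto (fun s : ℕ => (s : ℝ) + 1) Filter.atTop Filter.atTop :=
    Filter.tendsto_atTop_add_const_right _ _ tendsto_natCast_atTop_atTop
  have h1 : Filter.Tendsto (fun s : ℕ => 4 * T * κ / ((s : ℝ) + 1)) Filter.atTop (nhds 0) :=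
    hcast.const_div_atTop _
  have h2 : Filter.Tendsto (fun s : ℕ => Real.log (d * ((s : ℝ) + 1) / δ) / ((s : ℝ) + 1))
      Filter.atTop (nhds 0) := by
    by_cases hD : (d : ℝ) / δ = 0
    · have : ∀ s : ℕ, Real.log (d * ((s : ℝ) + 1) / δ) / ((s : ℝ) + 1) = 0 := fun s => by
        rw [mul_div_right_comm, hD]; simp
      simp_rw [this]
      exact tendsto_const_nhds
    · have h3 : Filter.Tendsto (fun y : ℝ => Real.log y / y) Filter.atTop (nhds 0) := by
        simpa using (Real.isLittleO_log_id_atTop).tendsto_div_nhds_zero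
      have h4 : Filter.Tendsto (fun s : ℕ => Real.log (d / δ) / ((s : ℝ) + 1)
          + Real.log ((s : ℝ) + 1) / ((s : ℝ) + 1)) Filter.atTop (nhds 0) := by
        simpa using (hcast.const_div_atTop (Real.log (d / δ))).add (h3.comp hcast)
      refine h4.congr fun s => ?_
      rw [mul_div_right_comm, Real.log_mul hD (by positivity), add_div]
  have h5 := h1.add ((h2.sqrt).const_mul (8 * Υ))
  simp only [Real.sqrt_zero, mul_zero, add_zero] at h5
  exact h5

/-- After `timeTwo` further contractions the initial gap `Δ` has become small. -/
lemma gap_rpow_le_of_timeTwo_le {β ρ ε ν κ lmin L Δ y : ℝ} (hφ0 : 0 < linRate β ρ ε κ)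
    (hφ1 : linRate β ρ ε κ < 1) (hν : 0 < ν) (hlmin : 0 < lmin) (hL : 0 < L) (hΔ : 0 ≤ Δ)
    (hy : timeTwo β ρ ε ν κ lmin L Δ ≤ y) :
    3 * L ^ 2 * (Δ * (1 - linRate β ρ ε κ) ^ y) ≤ ν ^ 2 * lmin ^ 3 := by
  rcases hΔ.eq_or_lt with rfl | hΔpos
  · simp; positivity
  set φ := linRate β ρ ε κ with hφ
  set a := 3 * L ^ 2 * Δ / (ν ^ 2 * lmin ^ 3) with ha
  have ha0 : 0 < a := by positivity
  have hy0 : 0 ≤ y := (le_max_left _ _).trans hy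
  have hφinv : κ ^ 2 * (1 + ε) / (4 * ρ * β * (1 - β) * (1 - ε)) = φ⁻¹ := by
    rw [hφ, linRate, inv_div]
  have h1 : φ⁻¹ * Real.log a ≤ y := by
    have := (le_max_right _ _).trans hy
    rwa [hφinv] at this
  have h2 : Real.log a ≤ φ * y := by
    rw [inv_mul_le_iff₀ hφ0] at h1; exact h1
  have h3 : (1 - φ) ^ y ≤ a⁻¹ := by
    have h4 : 1 - φ ≤ Real.exp (-φ) := by linarith [Real.add_one_le_exp (-φ)]
    calc (1 - φ) ^ y ≤ Real.exp (-φ) ^ y := Real.rpow_le_rpow (by linarith) h4 hy0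
      _ = Real.exp (-φ * y) := (Real.exp_mul _ _).symm
      _ ≤ Real.exp (-Real.log a) := Real.exp_le_exp.2 (by linarith)
      _ = a⁻¹ := by rw [Real.exp_neg, Real.exp_log ha0]
  calc 3 * L ^ 2 * (Δ * (1 - φ) ^ y) ≤ 3 * L ^ 2 * (Δ * a⁻¹) := by gcongr
    _ = ν ^ 2 * lmin ^ 3 := by rw [ha]; field_simp

end Times

/-! ### Trajectories with well-behaved noise -/

/-- The arithmetic mean of the Hessians at the first `t + 1` iterates. -/
noncomputable def hessMean {d : ℕ} (f : Vec d → ℝ) (x : ℕ → Vec d) (t : ℕ) : Op d :=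
  ((t : ℝ) + 1)⁻¹ • ∑ i ∈ Finset.range (t + 1), hess f (x i)

namespace HessianBounds

variable {d : ℕ} {f : Vec d → ℝ} {lmin lmax L : ℝ}

lemma hessMean_isSelfAdjoint (hB : HessianBounds f lmin lmax L) (x : ℕ → Vec d) (t : ℕ) :
    IsSelfAdjoint (hessMean f x t) := by
  refine IsSelfAdjoint.smul_op ?_ _
  induction t + 1 with
  | zero =>
    rw [Finset.range_zero, Finset.sum_empty, ContinuousLinearMap.isSelfAdjoint_iff_isSymmetric]
    exact LinearMap.IsSymmetric.zero
  | succ n ih => rw [Finset.sum_range_succ]; exact ih.add_op (hB.isSelfAdjoint_hess _)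

lemma inner_hessMean (x : ℕ → Vec d) (t : ℕ) (v : Vec d) : inner ℝ v (hessMean f x t v)
    = ((t : ℝ) + 1)⁻¹ * ∑ i ∈ Finset.range (t + 1), inner ℝ v (hess f (x i) v) := by
  rw [hessMean, smul_apply, real_inner_smul_right, sum_apply, inner_sum]

lemma lower_hessMean_add (hB : HessianBounds f lmin lmax L) (x : ℕ → Vec d) (t : ℕ) {N : Op d}
    {ε : ℝ} (hN : ‖N‖ ≤ ε * lmin) (v : Vec d) :
    (1 - ε) * lmin * ‖v‖ ^ 2 ≤ inner ℝ v ((hessMean f x t + N) v) := by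
  have h1 : lmin * ‖v‖ ^ 2 ≤ inner ℝ v (hessMean f x t v) := by
    rw [inner_hessMean, inv_mul_eq_div, le_div_iff₀ (by positivity)]
    have := Finset.card_nsmul_le_sum (Finset.range (t + 1))
      (fun i => inner ℝ v (hess f (x i) v)) _ fun i _ => hB.lower (x i) v
    rw [Finset.card_range, nsmul_eq_mul] at this
    push_cast at this
    linarith
  have h2 := (abs_le.1 (abs_inner_map_le N v v)).1
  have h3 : ‖N‖ * ‖v‖ * ‖v‖ ≤ ε * lmin * ‖v‖ ^ 2 := by
    rw [mul_assoc, ← sq]; gcongr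
  rw [add_apply, inner_add_right]
  linarith

lemma hessMean_add_upper (hB : HessianBounds f lmin lmax L) (x : ℕ → Vec d) (t : ℕ) {N : Op d}
    {ε : ℝ} (hε : 0 ≤ ε) (hN : ‖N‖ ≤ ε * lmin) (v : Vec d) :
    inner ℝ v ((hessMean f x t + N) v) ≤ (1 + ε) * lmax * ‖v‖ ^ 2 := by
  have h1 : inner ℝ v (hessMean f x t v) ≤ lmax * ‖v‖ ^ 2 := by
    rw [inner_hessMean, inv_mul_eq_div, div_le_iff₀ (by positivity)]
    have := Finset.sum_le_card_nsmul (Finset.range (t + 1))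
      (fun i => inner ℝ v (hess f (x i) v)) _ fun i _ => hB.upper (x i) v
    rw [Finset.card_range, nsmul_eq_mul] at this
    push_cast at this
    linarith
  have h2 := (abs_le.1 (abs_inner_map_le N v v)).2
  have h3 : ‖N‖ * ‖v‖ * ‖v‖ ≤ ε * lmax * ‖v‖ ^ 2 := by
    rw [mul_assoc, ← sq]
    have := mul_le_mul_of_nonneg_left hB.le hε
    gcongr
    linarith
  rw [add_apply, inner_add_right]
  linarith

variable {β ρ ε : ℝ} {x : ℕ → Vec d} {N : ℕ → Op d} {xs : Vec d} {T₁ : ℝ}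

/-- The objective never increases, and its gap contracts as soon as the noise average is small.
The exponent is stated with a maximum because `T₁` need not be an integer: the step that crosses
`T₁` already contracts, since its matrix averages at least `T₁` samples. -/
lemma gap_iterate_le (hB : HessianBounds f lmin lmax L) (hβ : 0 < β ∧ β < 1 / 2)
    (hρ : 0 < ρ ∧ ρ < 1) (hε : 0 < ε ∧ ε < 1) (hxs : ∀ x, f xs ≤ f x) (hT₁ : 0 ≤ T₁)
    (hstep : ∀ t, IsNewtonStep f β ρ (hessMean f x t + N t) (x t) (x (t + 1)))
    (hNsa : ∀ t, IsSelfAdjoint (N t)) (hN : ∀ t : ℕ, T₁ ≤ (t : ℝ) + 1 → ‖N t‖ ≤ ε * lmin) (t : ℕ) :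
    f (x t) - f xs
      ≤ (f (x 0) - f xs) * (1 - linRate β ρ ε (lmax / lmin)) ^ (max 0 ((t : ℝ) - T₁)) := by
  set φ := linRate β ρ ε (lmax / lmin) with hφ
  obtain ⟨hφ0, hφ1⟩ : 0 < φ ∧ φ < 1 :=
    linRate_pos_lt_one hβ hρ hε ((one_le_div hB.lmin_pos).2 hB.le)
  have hΔ : 0 ≤ f (x 0) - f xs := sub_nonneg.2 (hxs _)
  have hbase : 0 < 1 - φ := by linarith
  induction t with
  | zero =>
    rw [Nat.cast_zero, zero_sub, max_eq_left (by linarith), Real.rpow_zero, mul_one]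
  | succ t ih =>
    push_cast
    rcases lt_or_ge ((t : ℝ) + 1) T₁ with h | h
    · rw [max_eq_left (by linarith), Real.rpow_zero, mul_one]
      rw [max_eq_left (by linarith), Real.rpow_zero, mul_one] at ih
      linarith [(hstep t).apply_le hβ.1 hρ.1]
    · have h1 := hB.gap_newtonStep_le hβ hρ hε ((hB.hessMean_isSelfAdjoint x t).add_op (hNsa t))
        (hB.lower_hessMean_add x t (hN t h)) (hB.hessMean_add_upper x t hε.1.le (hN t h)) hxs
        (hstep t)
      refine h1.trans ((mul_le_mul_of_nonneg_left ih hbase.le).trans ?_)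
      have h2 : (1 - φ) * (1 - φ) ^ (max 0 ((t : ℝ) - T₁))
          ≤ (1 - φ) ^ (max 0 ((t : ℝ) + 1 - T₁)) := by
        rw [mul_comm, ← Real.rpow_add_one hbase.ne']
        refine Real.rpow_le_rpow_of_exponent_ge hbase (by linarith) ?_
        refine max_le ?_ ?_
        · linarith [le_max_left 0 ((t : ℝ) - T₁)]
        · linarith [le_max_right 0 ((t : ℝ) - T₁)]
      nlinarith [mul_le_mul_of_nonneg_left h2 hΔ]

/-- A small objective gap places the point in the neighborhood of the minimizer. -/
lemma mem_nbhd_of_gap_le (hB : HessianBounds f lmin lmax L) (hxs : ∀ x, f xs ≤ f x) {ν : ℝ}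
    (hν : 0 < ν) (hν1 : ν ≤ 1 / 48) {y : Vec d}
    (hy : 3 * L ^ 2 * (f y - f xs) ≤ ν ^ 2 * lmin ^ 3) : y ∈ nbhd f xs ν lmin L := by
  have hm := hB.lmin_pos
  have hL := hB.L_pos
  have h1 := hB.strong_convexity hxs y
  have h2 : L * ‖y - xs‖ ≤ 1 / 3 * lmin := by
    refine (abs_le_of_sq_le_sq' ?_ (by positivity)).2
    refine le_of_mul_le_mul_left ?_ hm
    have h3 : lmin * (L * ‖y - xs‖) ^ 2 ≤ L ^ 2 * (2 * (f y - f xs)) := by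
      have := mul_le_mul_of_nonneg_left h1 (sq_nonneg L)
      nlinarith
    have h4 : ν ^ 2 ≤ (1 / 48) ^ 2 := pow_le_pow_left₀ hν.le hν1 2
    have h5 := mul_le_mul_of_nonneg_right h4 (by positivity : 0 ≤ lmin ^ 3)
    have h6 : lmin * (1 / 3 * lmin) ^ 2 = 1 / 9 * lmin ^ 3 := by ring
    rw [h6]
    have h7 : 0 < lmin ^ 3 := by positivity
    linarith
  have h3 := hB.matNorm_sq_le_gap hxs h2
  rw [nbhd, Set.mem_ofPred_eq, le_div_iff₀ hL]
  refine (abs_le_of_sq_le_sq' ?_ (by positivity)).2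
  have h4 : (lmin ^ (3 / 2 : ℝ)) ^ 2 = lmin ^ 3 := by
    rw [← Real.rpow_natCast, ← Real.rpow_mul hm.le, ← Real.rpow_natCast]
    norm_num
  rw [mul_pow, mul_pow, h4]
  have := mul_le_mul_of_nonneg_right h3 (sq_nonneg L)
  linarith

/-- The averaged matrix is close to the Hessian at the minimizer when the iterates are. -/
lemma norm_hessMean_add_sub_le (hB : HessianBounds f lmin lmax L) (s : ℕ) {M : Op d} {e : ℝ}
    (hM : ‖M‖ ≤ e * lmin) : ‖hessMean f x s + M - hess f xs‖
      ≤ ((∑ i ∈ Finset.range (s + 1), ‖hess f (x i) - hess f xs‖ / lmin) / (s + 1) + e) * lmin := by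
  have hm := hB.lmin_pos
  have hs : (s : ℝ) + 1 ≠ 0 := by positivity
  have h1 : hessMean f x s + M - hess f xs
      = ((s : ℝ) + 1)⁻¹ • ∑ i ∈ Finset.range (s + 1), (hess f (x i) - hess f xs) + M := by
    rw [Finset.sum_sub_distrib, Finset.sum_const, Finset.card_range, ← Nat.cast_smul_eq_nsmul ℝ,
      smul_sub, smul_smul]
    push_cast
    rw [inv_mul_cancel₀ hs, one_smul, hessMean]
    abel
  rw [h1]
  refine (norm_add_le _ _).trans ?_
  rw [norm_smul, norm_inv, Real.norm_of_nonneg (by positivity : (0 : ℝ) ≤ s + 1), add_mul]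
  refine add_le_add ?_ hM
  rw [← Finset.sum_div, div_div, div_mul_eq_mul_div, mul_comm lmin, mul_div_mul_right _ _ hm.ne',
    inv_mul_eq_div]
  gcongr
  exact norm_sum_le _ _

/-- Superlinear phase: once the iterates stay in the neighborhood of the minimizer from `T` on and
the noise average is small, the matrix averages at least `T + J` samples of which all but about `T`
are accurate, so that full steps are taken and the error is first halved in every step; the errors
in the averaged matrix are then summable, which gives the rate. -/
lemma matNorm_superlinear (hB : HessianBounds f lmin lmax L) (hxs : ∀ x, f xs ≤ f x)
    (hβ : 0 < β ∧ β < 1 / 2) (hε : 0 < ε) {ν : ℝ} (hν : 0 < ν)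
    (hεν : max ε ν ≤ min (1 / 3 * ((0.5 - β) / (1.5 - β))) (1 / 48)) {κ T J : ℝ} {e : ℕ → ℝ}
    (hκ : κ = lmax / lmin) (hT : 4 ≤ T) (hJ : J = 4 * T * κ / ν)
    (hstep : ∀ t, IsNewtonStep f β ρ (hessMean f x t + N t) (x t) (x (t + 1)))
    (he0 : ∀ s, 0 ≤ e s) (heε : ∀ s : ℕ, T ≤ s → e s ≤ ε)
    (hN : ∀ s : ℕ, T ≤ s → ‖N s‖ ≤ e s * lmin)
    (hnbhd : ∀ t : ℕ, T ≤ t → x t ∈ nbhd f xs ν lmin L) {s : ℕ} (hs : T + J ≤ s) :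
    matNorm (hess f xs) (x (s + 1) - xs)
      ≤ 12 * (4 * T * κ / (s + 1) + e s) * matNorm (hess f xs) (x s - xs) := by
  have hm := hB.lmin_pos
  have hL := hB.L_pos
  have hκ1 : 1 ≤ κ := by rw [hκ]; exact (one_le_div hm).2 hB.le
  set b := min (1 / 3 * ((0.5 - β) / (1.5 - β))) (1 / 48 : ℝ) with hb
  have hεb : ε ≤ b := (le_max_left _ _).trans hεν
  have hνb : ν ≤ b := (le_max_right _ _).trans hεν
  have hb48 : b ≤ 1 / 48 := min_le_right _ _
  have hbβ : 3 * b * (1.5 - β) ≤ 0.5 - β := by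
    have h1 : b ≤ 1 / 3 * ((0.5 - β) / (1.5 - β)) := min_le_left _ _
    have h2 : (0 : ℝ) < 1.5 - β := by norm_num; linarith [hβ.2]
    rw [mul_div_assoc', le_div_iff₀ h2] at h1
    linarith
  have hTκ : 4 ≤ T * κ := by nlinarith
  have hJν : J * ν = 4 * (T * κ) := by rw [hJ]; field_simp
  have hJ0 : 0 < J := by rw [hJ]; positivity
  set Λ := lmin ^ (3 / 2 : ℝ) with hΛ
  have hΛ0 : 0 < Λ := by positivity
  set r : ℕ → ℝ := fun i => L * matNorm (hess f xs) (x i - xs) / Λ with hr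
  have hrΛ : ∀ i, L * matNorm (hess f xs) (x i - xs) = r i * Λ := fun i => by
    rw [hr]; field_simp
  have hr0 : ∀ i, 0 ≤ r i := fun i =>
    div_nonneg (mul_nonneg hL.le (Real.sqrt_nonneg _)) hΛ0.le
  have hrν : ∀ i : ℕ, T ≤ i → r i ≤ ν := fun i hi => by
    have := hnbhd i hi
    rw [nbhd, Set.mem_ofPred_eq, le_div_iff₀ hL] at this
    rw [hr, div_le_iff₀ hΛ0]
    linarith
  set h : ℕ → ℝ := fun i => ‖hess f (x i) - hess f xs‖ / lmin with hh
  have hhκ : ∀ i, h i ≤ 2 * κ := fun i => by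
    rw [hh, div_le_iff₀ hm, hκ, mul_div_assoc', div_mul_cancel₀ _ hm.ne']
    have := norm_sub_le (hess f (x i)) (hess f xs)
    linarith [hB.norm_hess_le (x i), hB.norm_hess_le xs]
  have hhr : ∀ i, h i ≤ r i := fun i => by
    rw [hh, div_le_iff₀ hm]
    exact (hB.lip _ _).trans (hB.norm_le_of_matNorm_le (hrΛ i).le)
  have hceil : (⌈T⌉₊ : ℝ) ≤ T + 1 := (Nat.ceil_lt_add_one (by linarith)).le
  -- At most `T + 1 ≤ 1.25 T` Hessians are sampled outside the neighborhood, each at a relative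
  -- distance of at most `2 κ`.
  have hsum : ∀ n : ℕ, ∑ i ∈ Finset.range n, h i ≤ 2.5 * (T * κ) + n * ν := by
    intro n
    refine (sum_range_le_of_le hν.le hhκ (by linarith) (fun i hi =>
      (hhr i).trans (hrν i (Nat.ceil_le.1 hi))) n).trans ?_
    have := mul_le_mul_of_nonneg_right hceil (by linarith : 0 ≤ 2 * κ)
    nlinarith
  -- The relative distance between the averaged matrix and the Hessian at the minimizer.
  set η : ℕ → ℝ := fun s => (∑ i ∈ Finset.range (s + 1), h i) / (s + 1) + e s with hη
  have hηle : ∀ s : ℕ, T + J ≤ s → η s ≤ 2.7 * b := by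
    intro s hs
    have h1 : (0 : ℝ) < s + 1 := by positivity
    have h2 : (∑ i ∈ Finset.range (s + 1), h i) / (s + 1) ≤ 1.65 * ν := by
      rw [div_le_iff₀ h1]
      have h3 := hsum (s + 1)
      push_cast at h3
      have h4 := mul_le_mul_of_nonneg_right (by linarith : J ≤ (s : ℝ) + 1) hν.le
      linarith
    have h3 := heε s (by linarith)
    rw [hη]
    linarith
  have hcontr : ∀ s : ℕ, T + J ≤ s → matNorm (hess f xs) (x (s + 1) - xs)
      ≤ (r s + η s) / (1 - η s) * matNorm (hess f xs) (x s - xs) := by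
    intro s hs
    have h1 := hηle s hs
    have h2 := hrν s (by linarith)
    have hη1 : 0 < 1 - η s := by linarith
    refine hB.matNorm_newtonStep_le hxs (ν := ν) (by linarith [hβ.2]) (by linarith)
      (hB.norm_hessMean_add_sub_le s (hN s (by linarith))) (hrΛ s).le h2 ?_ ?_ (hstep s)
    · rw [div_le_one hη1]; linarith
    · have h3 := mul_le_mul_of_nonneg_left h1 (by linarith [hβ.2] : 0 ≤ 1 - β)
      have : 0 ≤ b * (1 - β) := mul_nonneg (hν.le.trans hνb) (by linarith [hβ.2])
      norm_num at hbβ h3 ⊢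
      linarith
  have hhalf : ∀ s : ℕ, ⌈T + J⌉₊ ≤ s → r (s + 1) ≤ 1 / 2 * r s := by
    intro s hs
    have hs' := Nat.ceil_le.1 hs
    have h1 := hηle s hs'
    have h2 := hrν s (by linarith)
    have hη1 : 0 < 1 - η s := by linarith
    have h3 : (r s + η s) / (1 - η s) ≤ 1 / 2 := by
      rw [div_le_iff₀ hη1]; linarith
    have h4 := (hcontr s hs').trans (mul_le_mul_of_nonneg_right h3 (Real.sqrt_nonneg _))
    have h5 := mul_le_mul_of_nonneg_left h4 hL.le
    rw [hr]
    simp only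
    rw [div_le_iff₀ hΛ0]
    calc _ ≤ _ := h5
      _ = _ := by field_simp
  have hs' : ⌈T + J⌉₊ ≤ s := Nat.ceil_le.2 hs
  have hceil' : (⌈T + J⌉₊ : ℝ) ≤ T + J + 1 := (Nat.ceil_lt_add_one (by linarith)).le
  obtain ⟨hR, hrs⟩ := halving_bounds hν.le
    (hrν _ ((by linarith : T ≤ T + J).trans (Nat.le_ceil _))) hhalf hs'
  have hνT : ν * T ≤ 1 / 48 * (T * κ) := by
    have : ν * T ≤ 1 / 48 * T := mul_le_mul_of_nonneg_right (hνb.trans hb48) (by linarith)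
    nlinarith
  have hν48 : ν ≤ 1 / 48 := hνb.trans hb48
  have hrs' : r s * (s + 1) ≤ 4.1 * (T * κ) := by
    refine hrs.trans ?_
    have := mul_le_mul_of_nonneg_left hceil' hν.le
    linarith
  -- Beyond `T + J` the errors add up to at most `2 ν`, so the sum no longer grows with `s`.
  have hsum' : ∑ i ∈ Finset.range (s + 1), h i ≤ 6.6 * (T * κ) := by
    rw [← Finset.sum_range_add_sum_Ico _ (by omega : ⌈T + J⌉₊ ≤ s + 1)]
    have h1 := hsum ⌈T + J⌉₊
    have h2 : ∑ i ∈ Finset.Ico ⌈T + J⌉₊ (s + 1), h i ≤ 2 * ν :=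
      (Finset.sum_le_sum fun i _ => hhr i).trans (by linarith [hr0 s])
    have h3 := mul_le_mul_of_nonneg_right hceil' hν.le
    linarith
  refine (hcontr s hs).trans (mul_le_mul_of_nonneg_right ?_ (Real.sqrt_nonneg _))
  have h1 := hηle s hs
  have hη1 : 0 < 1 - η s := by linarith
  have hpos : (0 : ℝ) < s + 1 := by positivity
  have h2 : r s + η s ≤ 10.7 * (T * κ / (s + 1)) + e s := by
    have h3 : r s ≤ 4.1 * (T * κ / (s + 1)) := by
      rw [mul_div_assoc', le_div_iff₀ hpos]; exact hrs'
    have h4 : (∑ i ∈ Finset.range (s + 1), h i) / (s + 1) ≤ 6.6 * (T * κ / (s + 1)) := by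
      rw [mul_div_assoc']; gcongr
    rw [hη]
    simp only
    linarith
  have h5 : 0 ≤ T * κ / (s + 1) := by positivity
  rw [div_le_iff₀ hη1]
  have h6 : 4 * T * κ / (s + 1) = 4 * (T * κ / (s + 1)) := by ring
  rw [h6]
  have h7 : (1 / 2 : ℝ) ≤ 1 - η s := by linarith
  have h8 := mul_le_mul_of_nonneg_left h7
    (by linarith [he0 s] : 0 ≤ 12 * (4 * (T * κ / (s + 1)) + e s))
  linarith [he0 s]

end HessianBounds

/-! ### Convergence on the event of small noise averages -/

lemma IsAveragedNewton.measure_goodNoise_ge {d : ℕ} {Ω : Type*} {mΩ : MeasurableSpace Ω}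
    {P : Measure Ω} [IsProbabilityMeasure P] {ℱ : Filtration ℕ mΩ} {Q : Kernel (Vec d) (Op d)}
    [IsMarkovKernel Q] {f : Vec d → ℝ} {w : ℤ → ℝ} {β ρ : ℝ} {x₀ : Vec d} {x : ℕ → Ω → Vec d}
    {E : ℕ → Ω → Op d} {ΥE δ : ℝ} (hrun : IsAveragedNewton P ℱ Q f w β ρ x₀ x E)
    (hQ : IsSubExpNoise Q ΥE) (hδ : 0 < δ) (hdδ : Real.exp 1 ≤ d / δ) :
    ENNReal.ofReal (1 - δ * Real.pi ^ 2 / 6) ≤ P {ω | (∀ t, IsSelfAdjoint (E t ω)) ∧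
      ∀ n : ℕ, 1 ≤ n → Real.log (d * n / δ) ≤ n →
        ‖noiseSum E n ω‖ ≤ n * (8 * ΥE * √(Real.log (d * n / δ) / n))} := by
  set good := {ω | (∀ t, IsSelfAdjoint (E t ω)) ∧
      ∀ n : ℕ, 1 ≤ n → Real.log (d * n / δ) ≤ n →
        ‖noiseSum E n ω‖ ≤ n * (8 * ΥE * √(Real.log (d * n / δ) / n))} with hgood
  set bad : ℕ → Set Ω := fun n => {ω | (1 ≤ n ∧ Real.log (d * n / δ) ≤ n) ∧
    n * (8 * ΥE * √(Real.log (d * n / δ) / n)) < ‖noiseSum E n ω‖} with hbad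
  have hsa : P {ω | ∀ t, IsSelfAdjoint (E t ω)}ᶜ = 0 := by
    have hclosed : MeasurableSet {M : Op d | IsSelfAdjoint M} := by
      have : {M : Op d | IsSelfAdjoint M} = {M | ContinuousLinearMap.adjoint M = M} := by
        ext M; exact ContinuousLinearMap.isSelfAdjoint_iff'
      rw [this]
      exact (isClosed_eq (ContinuousLinearMap.adjoint (𝕜 := ℝ) (E := Vec d)
        (F := Vec d)).continuous continuous_id).measurableSet
    exact ae_iff.1 (ae_all_iff.2 fun t => hrun.ae_noise t hclosed hQ.symm)
  have hbadn : ∀ n, P (bad n) ≤ ENNReal.ofReal (δ * (1 / (n : ℝ) ^ 2)) := by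
    intro n
    by_cases hn : 1 ≤ n ∧ Real.log (d * n / δ) ≤ n
    · exact (measure_mono fun ω hω => hω.2).trans
        (hrun.measure_noiseSum_bad_le hQ hδ hdδ hn.1 hn.2)
    · have : bad n = ∅ := Set.eq_empty_of_forall_notMem fun ω hω => hn hω.1
      rw [this, measure_empty]
      exact zero_le
  have hcompl : P goodᶜ ≤ ENNReal.ofReal (δ * Real.pi ^ 2 / 6) := by
    have hsub : goodᶜ ⊆ {ω | ∀ t, IsSelfAdjoint (E t ω)}ᶜ ∪ ⋃ n, bad n := by
      intro ω hω
      by_contra hc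
      simp only [Set.mem_union, Set.mem_iUnion, not_or, not_exists, Set.notMem_compl_iff] at hc
      exact hω ⟨hc.1, fun n hn hl => not_lt.1 fun hlt => hc.2 n ⟨⟨hn, hl⟩, hlt⟩⟩
    have hz := hasSum_zeta_two.mul_left δ
    calc P goodᶜ ≤ P {ω | ∀ t, IsSelfAdjoint (E t ω)}ᶜ + P (⋃ n, bad n) :=
          (measure_mono hsub).trans (measure_union_le _ _)
      _ ≤ ∑' n, P (bad n) := by rw [hsa, zero_add]; exact measure_iUnion_le _
      _ ≤ ∑' n : ℕ, ENNReal.ofReal (δ * (1 / (n : ℝ) ^ 2)) := ENNReal.tsum_le_tsum hbadn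
      _ = ENNReal.ofReal (δ * Real.pi ^ 2 / 6) := by
          rw [← ENNReal.ofReal_tsum_of_nonneg (fun n => by positivity) hz.summable, hz.tsum_eq,
            mul_div_assoc]
  rw [ENNReal.ofReal_sub _ (by positivity), ENNReal.ofReal_one, tsub_le_iff_right]
  calc (1 : ENNReal) = P Set.univ := measure_univ.symm
    _ ≤ P (good ∪ goodᶜ) := by rw [Set.union_compl_self]
    _ ≤ P good + P goodᶜ := measure_union_le _ _
    _ ≤ _ := by gcongr

theorem mainTheorem1
    (d : ℕ) {Ω : Type*} {mΩ : MeasurableSpace Ω} (P : Measure Ω) [IsProbabilityMeasure P]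
    -- the objective: twice continuously differentiable, `lmin I ⪯ ∇²f ⪯ lmax I`, `L`-Lipschitz Hessian
    (f : Vec d → ℝ) (hf : ContDiff ℝ 2 f)
    (lmin lmax : ℝ) (hlmin : 0 < lmin) (hlmax : lmin ≤ lmax)
    (hess_lower : ∀ x v, lmin * ‖v‖ ^ 2 ≤ inner ℝ v (hess f x v))
    (hess_upper : ∀ x v, inner ℝ v (hess f x v) ≤ lmax * ‖v‖ ^ 2)
    (L : ℝ) (hL : 0 < L) (hess_lip : ∀ x y, ‖hess f x - hess f y‖ ≤ L * ‖x - y‖)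
    (xs : Vec d) (hxs : ∀ x, f xs ≤ f x)
    -- the oracle
    (Q : Kernel (Vec d) (Op d)) [IsMarkovKernel Q] (ΥE : ℝ) (hQ : IsSubExpNoise Q ΥE)
    -- the algorithm with uniform weights
    (β ρ : ℝ) (hβ : 0 < β ∧ β < 1 / 2) (hρ : 0 < ρ ∧ ρ < 1)
    (x₀ : Vec d) (ℱ : Filtration ℕ mΩ) (x : ℕ → Ω → Vec d) (E : ℕ → Ω → Op d)
    (hrun : IsAveragedNewton P ℱ Q f uniformWeights β ρ x₀ x E)
    -- the parameters
    (δ ε ν : ℝ) (hδ : 0 < δ ∧ δ < 1) (hdδ : Real.exp 1 ≤ d / δ)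
    (hε : 0 < ε ∧ ε < 1) (hν : 0 < ν ∧ ν < 1)
    (hεν : max ε ν ≤ min (1 / 3 * ((0.5 - β) / (1.5 - β))) (1 / 48))
    (κ Υ Δ φ T₁ T₂ T J : ℝ)
    (hκ : κ = lmax / lmin) (hΥ : Υ = ΥE / lmin) (hΔ : Δ = f x₀ - f xs)
    (hφ : φ = linRate β ρ ε κ)
    (hT₁ : T₁ = timeOne d δ ε Υ)
    (hT₂ : T₂ = timeTwo β ρ ε ν κ lmin L Δ)
    (hT : T = T₁ + T₂)
    (hJ : J = 4 * T * κ / ν) :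
    -- the rate is at most `1 / 24` and tends to zero
    (∀ s : ℕ, T + J ≤ s → 24 * superRate d δ Υ κ T s ≤ 1) ∧
    Filter.Tendsto (superRate d δ Υ κ T) Filter.atTop (nhds 0) ∧
    (0 < φ ∧ φ < 1) ∧
    -- one event of probability at least `1 - δ π² / 6` on which all the following hold
    ENNReal.ofReal (1 - δ * Real.pi ^ 2 / 6) ≤ P {ω |
      -- R-linear convergence from `T₁` on
      (∀ t : ℕ, T₁ ≤ t →
        ‖x t ω - xs‖ ≤ √(2 / lmin * Δ * (1 - φ) ^ ((t : ℝ) - T₁)) ∧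
        matNorm (hess f xs) (x t ω - xs) ≤ √(2 * κ * Δ * (1 - φ) ^ ((t : ℝ) - T₁))) ∧
      -- the iterates are in the neighborhood from `T` on
      (∀ t : ℕ, T ≤ t → x t ω ∈ nbhd f xs ν lmin L) ∧
      -- superlinear convergence from `T + J` on
      (∀ s : ℕ, T + J ≤ s →
        matNorm (hess f xs) (x (s + 1) ω - xs) ≤
          12 * superRate d δ Υ κ T s * matNorm (hess f xs) (x s ω - xs))} := by

  have hB : HessianBounds f lmin lmax L :=
    ⟨hf, hlmin, hlmax, hess_lower, hess_upper, hL, hess_lip⟩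
  have hκ1 : 1 ≤ κ := by rw [hκ]; exact (one_le_div hlmin).2 hlmax
  have hT₁4 : 4 ≤ T₁ := by rw [hT₁]; exact four_le_timeOne hdδ
  have hT₂0 : 0 ≤ T₂ := by rw [hT₂]; exact le_max_left _ _
  have hT4 : 4 ≤ T := by linarith
  have hν48 : ν ≤ 1 / 48 := (le_max_right _ _).trans (hεν.trans (min_le_right _ _))
  have hε48 : ε ≤ 1 / 48 := (le_max_left _ _).trans (hεν.trans (min_le_right _ _))
  have hJν : J * ν = 4 * T * κ := by rw [hJ]; field_simp [hν.1.ne']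
  have hJ0 : 0 ≤ J := by
    have := hν.1
    rw [hJ]; positivity
  obtain ⟨hφ0, hφ1⟩ : 0 < φ ∧ φ < 1 := by rw [hφ]; exact linRate_pos_lt_one hβ hρ hε hκ1
  have hnoise : ∀ n : ℝ, T₁ ≤ n → 8 * Υ * √(Real.log (d * n / δ) / n) ≤ ε := fun n hn =>
    noise_rate_le_of_timeOne_le hdδ hε.1 (hT₁ ▸ hn)
  refine ⟨fun s hs => ?_, tendsto_superRate d δ Υ κ T, ⟨hφ0, hφ1⟩,
    (hrun.measure_goodNoise_ge hQ hδ.1 hdδ).trans (measure_mono ?_)⟩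
  · have h1 := hnoise ((s : ℝ) + 1) (by linarith)
    have h2 : 4 * T * κ / ((s : ℝ) + 1) ≤ ν := by
      rw [div_le_iff₀ (by positivity), ← hJν, mul_comm]
      exact mul_le_mul_of_nonneg_left (by linarith) hν.1.le
    unfold superRate
    linarith
  rintro ω ⟨hsa, hgood⟩
  set y : ℕ → Vec d := fun t => x t ω with hy
  set N : ℕ → Op d := fun t => ((t : ℝ) + 1)⁻¹ • noiseSum E (t + 1) ω with hN
  set e : ℕ → ℝ := fun s => 8 * Υ * √(Real.log (d * ((s : ℝ) + 1) / δ) / ((s : ℝ) + 1)) with he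
  have hΥ0 : 0 ≤ Υ := by rw [hΥ]; exact div_nonneg (hQ.subExp x₀).nonneg hlmin.le
  have hstep : ∀ t, IsNewtonStep f β ρ (hessMean f y t + N t) (y t) (y (t + 1)) := by
    intro t
    have h1 := hrun.step ω t
    rw [hessAvg_uniformWeights, Finset.sum_add_distrib, smul_add] at h1
    have h2 : ∑ i ∈ Finset.range (t + 1), E i ω = noiseSum E (t + 1) ω :=
      Finset.sum_congr rfl fun i _ => (symPart_eq_self (hsa i)).symm
    rw [h2] at h1
    exact h1
  have hNsa : ∀ t, IsSelfAdjoint (N t) := fun t => (noiseSum_isSelfAdjoint E _ ω).smul_op _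
  have hNe : ∀ t : ℕ, T₁ ≤ (t : ℝ) + 1 → ‖N t‖ ≤ e t * lmin := by
    intro t ht
    have h1 := hgood (t + 1) (by omega) (by
      push_cast
      exact log_le_of_timeOne_le hdδ (hT₁ ▸ ht))
    push_cast at h1
    rw [hN, norm_smul, norm_inv, Real.norm_of_nonneg (by positivity : (0 : ℝ) ≤ t + 1),
      inv_mul_le_iff₀ (by positivity)]
    refine h1.trans_eq ?_
    rw [he, hΥ]
    field_simp
  have hNε : ∀ t : ℕ, T₁ ≤ (t : ℝ) + 1 → ‖N t‖ ≤ ε * lmin := fun t ht =>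
    (hNe t ht).trans (mul_le_mul_of_nonneg_right (hnoise _ ht) hlmin.le)
  have hΔ0 : 0 ≤ Δ := by rw [hΔ]; exact sub_nonneg.2 (hxs _)
  have hgap : ∀ t : ℕ, T₁ ≤ t → f (y t) - f xs ≤ Δ * (1 - φ) ^ ((t : ℝ) - T₁) := by
    intro t ht
    have h1 := hB.gap_iterate_le hβ hρ hε hxs (by linarith) hstep hNsa hNε t
    have h2 : y 0 = x₀ := hrun.init ω
    rwa [max_eq_right (by linarith), h2, ← hΔ, ← hκ, ← hφ] at h1
  have hnbhd : ∀ t : ℕ, T ≤ t → y t ∈ nbhd f xs ν lmin L := by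
    intro t ht
    refine hB.mem_nbhd_of_gap_le hxs hν.1 hν48 ?_
    have h1 : timeTwo β ρ ε ν κ lmin L Δ ≤ (t : ℝ) - T₁ := by rw [← hT₂]; linarith
    have h2 := gap_rpow_le_of_timeTwo_le (hφ ▸ hφ0) (hφ ▸ hφ1) hν.1 hlmin hL hΔ0 h1
    rw [← hφ] at h2
    exact (mul_le_mul_of_nonneg_left (hgap t (by linarith)) (by positivity)).trans h2
  refine ⟨fun t ht => ⟨?_, ?_⟩, hnbhd, fun s hs => ?_⟩
  · refine Real.le_sqrt_of_sq_le ?_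
    have h1 := hB.strong_convexity hxs (y t)
    have h2 := hgap t ht
    rw [mul_assoc, div_mul_eq_mul_div, le_div_iff₀ hlmin]
    linarith
  · refine Real.le_sqrt_of_sq_le ?_
    have h1 := hB.strong_convexity hxs (y t)
    have h2 := hgap t ht
    rw [hB.matNorm_sq]
    refine (hB.upper xs _).trans ?_
    have h3 : lmax = κ * lmin := by rw [hκ]; field_simp
    rw [h3]
    have h4 := mul_le_mul_of_nonneg_left h1 (by linarith : 0 ≤ κ)
    have h5 := mul_le_mul_of_nonneg_left h2 (by linarith : 0 ≤ 2 * κ)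
    linarith
  · exact hB.matNorm_superlinear hxs hβ hε.1 hν.1 hεν hκ hT4 hJ hstep
      (fun s => by positivity) (fun s hs => hnoise _ (by linarith))
      (fun s hs => hNe s (by linarith)) hnbhd hs
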